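/- Write $Z=(z,w)\in\mathbb C^n\times\mathbb C=\mathbb C^{n+1}$. Let $M\subset\mathbb C^{n+1}$ be a real-analytic hypersurface through $0$, given in an open neighbourhood $\Omega$ of $0$ by $\rho(Z,\bar Z)=0$, where $\rho$ is real-analytic and real-valued, its complexification $\rho(Z,\chi)$ is holomorphic for $Z,\bar\chi\in\Omega$, and $\rho_w(0,0)\ne0$. Suppose that $M$ is transversally holomorphically embeddable into a real hyperquadric in $\mathbb C^{n+m+1}$: there are a real hyperquadric $M'\subset\mathbb C^{n+m+1}$, given in some linear coordinates $(z',w')\in\mathbb C^{n+m}\times\mathbb C$ by $\operatorname{Im}w'=h(z',\bar z')$ with $h$ a hermitian form, and a holomorphic embedding $H$ of a neighbourhood of $M$ into $\mathbb C^{n+m+1}$ with $H(M)\subset M'$ and $H_*(T_x\mathbb C^{n+1})+T_{H(x)}M'=T_{H(x)}\mathbb C^{n+m+1}$ for all $x\in M$. For $\zeta\in\Omega$ let $S_\zeta=\{Z\in\Omega:\rho(Z,\bar\zeta)=0\}$ be the Segre variety, let $T_0S_\zeta$ be the kernel of the differential of $Z\mapsto\rho(Z,\bar\zeta)$ at $Z=0$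 (for $\zeta \in S_0$ near $0$ this is the tangent space of $S_\zeta$ at $0$), and let $T_0^cM=T_0M\cap iT_0M$. For a proper subset $I\subset\{1,\dots,n\}$ put $$V_I=(\operatorname{span}\{e_j:j\in I\}\times\mathbb C)\cap T_0^cM,\qquad S_{0,V_I}=\{\zeta\in S_0:\ T_0S_\zeta\supset V_I\}.$$ Let $\alpha_1,\dots,\alpha_{m+1}\in\mathbb N^n$ be multiindices with $|\alpha_j|=2$ and $\operatorname{supp}\alpha_j=\{i:(\alpha_j)_i\neq0\}\subset I$. Then there are $(\lambda_1,\dots,\lambda_{m+1})\in\mathbb C^{m+1}\setminus\{0\}$ and a polynomial $R_1$ with complex coefficients and of total degree at most $1$ in its arguments, which are indexed by the multiindices $\beta\in\mathbb N^n$ with $|\beta|\le1$, such that $$\sum_{j=1}^{m+1}\lambda_j\,\frac{\rho_{z^{\alpha_j}}(0,\bar\zeta)}{\rho_w(0,\bar\zeta)}=R_1\!\left(\frac{\rho_{z^\beta}(0,\bar\zeta)}{\rho_w(0,\bar\zeta)},\frac{\rho_{z^\beta w}(0,\bar\zeta)}{\rho_w(0,\bar\zeta)},\frac{\rho_{w^2}(0,\bar\zeta)}{\rho_w(0,\bar\zeta)}\right),\qquad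 \zeta\in S_{0,V_I},$$ in the following sense: 1. for all $\zeta\in S_{0,V_I}$ sufficiently close to $0$, one has $\rho_w(0,\bar\zeta)\ne0$ and the relation holds; 2. with the same $\lambda_j$ and $R_1$, the relation holds at every point $\zeta$ with $\rho_w(0,\bar\zeta)\neq0$ of every connected embedded complex submanifold $A$ of $\mathbb C^{n+1}$ with $0\in A\subset S_{0,V_I}$ (in particular on all of $S_{0,V_I}$ outside $\{\rho_w(0,\bar\zeta)=0\}$, if $S_{0,V_I}$ itself is a connected complex submanifold). -/

import Mathlib

open Topology

noncomputable section

/-- `ℂⁿ⁺¹` with its splitting `Z = (z, w) ∈ ℂⁿ × ℂ`. On it `star` is the coordinatewise complex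
conjugation `Z ↦ Z̄`. -/
abbrev CSpace (n : ℕ) : Type := (Fin n → ℂ) × ℂ

/-! ### Partial derivatives -/

/-- The holomorphic partial derivative `∂f/∂z_j`. -/
def partialZ {n : ℕ} (j : Fin n) (f : CSpace n → ℂ) : CSpace n → ℂ :=
  fun Z => fderiv ℂ f Z (Pi.single j 1, 0)

/-- The holomorphic partial derivative `∂f/∂w`. -/
def partialW {n : ℕ} (f : CSpace n → ℂ) : CSpace n → ℂ :=
  fun Z => fderiv ℂ f Z (0, 1)

/-- `∂^{|β|+s} f / ∂z₁^{β₁} ⋯ ∂z_n^{β_n} ∂w^s`. -/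
def mixedPartial {n : ℕ} (β : Fin n → ℕ) (s : ℕ) (f : CSpace n → ℂ) : CSpace n → ℂ :=
  (List.finRange n).foldr (fun j g => (partialZ j)^[β j] g) (partialW^[s] f)

/-- `ρ_{z^β w^s}(0, ζ̄)`, the derivatives being taken in the first group of variables. -/
def rhoDeriv {n : ℕ} (ρ : CSpace n × CSpace n → ℂ) (β : Fin n → ℕ) (s : ℕ) (ζ : CSpace n) : ℂ :=
  mixedPartial β s (fun Z => ρ (Z, star ζ)) 0

/-! ### Real hypersurfaces through the origin and their Segre varieties -/

/-- `ρ(Z, Z̄)` is a real-analytic defining function, on the open neighbourhood `Ω` of `0`, of the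
hypersurface `M` through `0`, with `ρ_w(0, 0) ≠ 0`. Here `ρ(Z, χ)` is the complexification, a
holomorphic function for `Z ∈ Ω` and `χ̄ ∈ Ω`. Since `ρ(Z, Z̄)` is real, `ρ_w(0, 0) ≠ 0`
makes its real differential at `0` nonzero, so that near `0` the set `M` is a real-analytic
hypersurface. -/
structure IsDefiningFunction {n : ℕ} (M Ω : Set (CSpace n)) (ρ : CSpace n × CSpace n → ℂ) :
    Prop where
  isOpen : IsOpen Ω
  zero_mem : (0 : CSpace n) ∈ Ω
  analytic : AnalyticOnNhd ℂ ρ {p | p.1 ∈ Ω ∧ star p.2 ∈ Ω}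
  real : ∀ Z ∈ Ω, (ρ (Z, star Z)).im = 0
  mem_iff : ∀ Z ∈ Ω, (Z ∈ M ↔ ρ (Z, star Z) = 0)
  zero_mem_hypersurface : (0 : CSpace n) ∈ M
  rho_w_ne_zero : rhoDeriv ρ 0 1 0 ≠ 0

/-- The Segre variety `S_ζ = {Z ∈ Ω : ρ(Z, ζ̄) = 0}`. -/
def segreVariety {n : ℕ} (Ω : Set (CSpace n)) (ρ : CSpace n × CSpace n → ℂ) (ζ : CSpace n) :
    Set (CSpace n) :=
  {Z | Z ∈ Ω ∧ ρ (Z, star ζ) = 0}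

/-- The tangent space `T₀ S_ζ`, the kernel of the differential at `Z = 0` of the defining function
`ρ(Z, ζ̄)` of `S_ζ`. -/
def segreTangent {n : ℕ} (ρ : CSpace n × CSpace n → ℂ) (ζ : CSpace n) : Set (CSpace n) :=
  {v | fderiv ℂ (fun Z => ρ (Z, star ζ)) 0 v = 0}

/-- The real tangent space `T₀M`, the kernel of the real differential at `0` of `ρ(Z, Z̄)`. -/
def realTangent {n : ℕ} (ρ : CSpace n × CSpace n → ℂ) : Set (CSpace n) :=
  {v | fderiv ℝ (fun Z : CSpace n => (ρ (Z, star Z)).re) 0 v = 0}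

/-- The complex tangent space `T₀ᶜM = T₀M ∩ iT₀M`. -/
def complexTangent {n : ℕ} (ρ : CSpace n × CSpace n → ℂ) : Set (CSpace n) :=
  {v | v ∈ realTangent ρ ∧ Complex.I • v ∈ realTangent ρ}

/-- `V_I = (V_I⁰ × ℂ) ∩ T₀ᶜM`, where `V_I⁰ = span {e_j : j ∈ I} ⊂ ℂⁿ`. -/
def coordTangent {n : ℕ} (ρ : CSpace n × CSpace n → ℂ) (I : Finset (Fin n)) : Set (CSpace n) :=
  {v | v.1 ∈ Submodule.span ℂ ((fun j : Fin n => (Pi.single j 1 : Fin n → ℂ)) '' (I : Set (Fin n)))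
    ∧ v ∈ complexTangent ρ}

/-- `S_{0,V} = {ζ ∈ S₀ : T₀ S_ζ ⊃ V}`. -/
def distinguishedSegre {n : ℕ} (Ω : Set (CSpace n)) (ρ : CSpace n × CSpace n → ℂ)
    (V : Set (CSpace n)) : Set (CSpace n) :=
  {ζ | ζ ∈ segreVariety Ω ρ 0 ∧ V ⊆ segreTangent ρ ζ}

/-- `A` is an embedded complex submanifold of `ℂⁿ⁺¹`: near each of its points some biholomorphic
chart takes it to a complex linear subspace. -/
def IsComplexSubmanifold {n : ℕ} (A : Set (CSpace n)) : Prop :=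
  ∀ a ∈ A, ∃ (φ : OpenPartialHomeomorph (CSpace n) (CSpace n)) (L : Submodule ℂ (CSpace n)),
    a ∈ φ.source ∧ AnalyticOnNhd ℂ φ φ.source ∧ AnalyticOnNhd ℂ φ.symm φ.target ∧
    ∀ x ∈ φ.source, (x ∈ A ↔ φ x ∈ L)

/-! ### Real hyperquadrics and transversal embeddings -/

/-- `Im w - h(z, z̄)` in the linear coordinates `(z, w) = T Z` of `ℂᴺ⁺¹`, where `h` is the hermitian
form with matrix `A`. -/
def quadricFun {N : ℕ} (T : CSpace N ≃L[ℂ] CSpace N) (A : Matrix (Fin N) (Fin N) ℂ)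
    (Z : CSpace N) : ℝ :=
  (T Z).2.im - (∑ j, ∑ k, A j k * (T Z).1 j * star ((T Z).1 k)).re

/-- `M' ⊂ ℂᴺ⁺¹` is the real hyperquadric `Im w = h(z, z̄)` in the linear coordinates
`(z, w) = T Z`, with `h` the hermitian form with matrix `A`. -/
def IsHyperquadric {N : ℕ} (T : CSpace N ≃L[ℂ] CSpace N) (A : Matrix (Fin N) (Fin N) ℂ)
    (M' : Set (CSpace N)) : Prop :=
  A.IsHermitian ∧ M' = {Z | quadricFun T A Z = 0}

/-- `H` is a holomorphic embedding of the open neighbourhood `W` of `M` with `H(M) ⊂ M'`. -/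
structure IsHolomorphicEmbedding {n N : ℕ} (M W : Set (CSpace n)) (M' : Set (CSpace N))
    (H : CSpace n → CSpace N) : Prop where
  isOpen : IsOpen W
  subset : M ⊆ W
  holomorphic : AnalyticOnNhd ℂ H W
  immersion : ∀ x ∈ W, Function.Injective (fderiv ℂ H x)
  isEmbedding : IsEmbedding (W.domRestrict H)
  mapsTo : Set.MapsTo H M M'

/-- `M` is transversally holomorphically embeddable into a real hyperquadric `M'` in `ℂᴺ⁺¹`:
some holomorphic embedding `H` of a neighbourhood of `M` satisfies `H(M) ⊂ M'` and
`H_*(T_x ℂⁿ⁺¹) + T_{H(x)} M' = T_{H(x)} ℂᴺ⁺¹` for all `x ∈ M`. The function defining `M'` has no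
critical points, so that `T_{H(x)} M'` is the kernel of its real differential. -/
def TransversallyEmbeddableInHyperquadric {n : ℕ} (M : Set (CSpace n)) (N : ℕ) : Prop :=
  ∃ (T : CSpace N ≃L[ℂ] CSpace N) (A : Matrix (Fin N) (Fin N) ℂ) (M' : Set (CSpace N))
    (W : Set (CSpace n)) (H : CSpace n → CSpace N),
    IsHyperquadric T A M' ∧ IsHolomorphicEmbedding M W M' H ∧
    ∀ x ∈ M, ∀ u : CSpace N, ∃ (v : CSpace n) (t : CSpace N),
      fderiv ℝ (quadricFun T A) (H x) t = 0 ∧ u = fderiv ℂ H x v + t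

/-! ### The relation -/

/-- The arguments of the polynomial `R₁`: one for each `ρ_{z^β}/ρ_w` and each `ρ_{z^β w}/ρ_w` with
`|β| ≤ 1`, and one for `ρ_{w²}/ρ_w`. -/
inductive RelVar (n : ℕ) : Type
  | z (β : Fin n → ℕ) (hβ : ∑ i, β i ≤ 1) : RelVar n
  | zw (β : Fin n → ℕ) (hβ : ∑ i, β i ≤ 1) : RelVar n
  | ww : RelVar n

/-- The values of the arguments of `R₁` at `(0, ζ̄)`. -/
def RelVar.value {n : ℕ} (ρ : CSpace n × CSpace n → ℂ) (ζ : CSpace n) : RelVar n → ℂ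
  | .z β _ => rhoDeriv ρ β 0 ζ / rhoDeriv ρ 0 1 ζ
  | .zw β _ => rhoDeriv ρ β 1 ζ / rhoDeriv ρ 0 1 ζ
  | .ww => rhoDeriv ρ 0 2 ζ / rhoDeriv ρ 0 1 ζ

/-- The relation `∑_j λ_j ρ_{z^{α_j}}/ρ_w = R₁(ρ_{z^β}/ρ_w, ρ_{z^β w}/ρ_w, ρ_{w²}/ρ_w)` at
`(0, ζ̄)`. -/
def RelationAt {n m : ℕ} (ρ : CSpace n × CSpace n → ℂ) (α : Fin (m + 1) → Fin n → ℕ)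
    (c : Fin (m + 1) → ℂ) (R : MvPolynomial (RelVar n) ℂ) (ζ : CSpace n) : Prop :=
  ∑ j, c j * (rhoDeriv ρ (α j) 0 ζ / rhoDeriv ρ 0 1 ζ) =
    MvPolynomial.eval (RelVar.value ρ ζ) R

end

/-! Write `h` for the embedding in the linear coordinates of the hyperquadric. The equation of the
hyperquadric, pulled back by `h`, vanishes on `M`, so its polarization vanishes near `0` on the
complexified hypersurface `ρ(Z, χ) = 0` (`eventually_vanishing_of_totallyReal`). Freezing `χ = ζ̄`,
the germ of `S_ζ` at `0` is mapped into a hyperplane: an affine function `q_ζ` of `h` vanishes on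
it. For `ζ ∈ S₀` near `0` the point `0` lies on `S_ζ`, hence at `0` one has `dq_ζ = a dρ`, and
`d²q_ζ = a d²ρ` on tangent vectors of `S_ζ`; transversality gives `a ≠ 0`
(`eventually_exists_multiplier`).

The fields `L_i = ∂/∂z_i - s_i ∂/∂w`, `i ∈ I`, with constants `s_i` chosen so that they lie in
`V_I`, are tangent at `0` to every `S_ζ` with `ζ ∈ S_{0,V_I}`. The range of `dh(0)` has codimension
`m`, so the `m + 1` vectors `d²h(0)(L_i, L_k)` attached to the `α_j` are dependent modulo it
(`exists_relation_modulo_range`). This relation does not involve `ζ`. Applying the linear part of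
`q_ζ` and cancelling `a` turns it into a relation between derivatives of `ρ` at `(0, ζ̄)`; expanding
the `L_i` and dividing by `ρ_w` gives an affine polynomial. The undivided relation is real-analytic
in `ζ`, so it propagates along connected submanifolds (`IsComplexSubmanifold.eqOn_zero`). -/

noncomputable section

/-! ### Conjugation of holomorphic functions -/

/-- `v ↦ star (L (S v))` for a conjugate-linear `S` and a linear `L`. -/
def conjComp {E E' G : Type*} [NormedAddCommGroup E] [NormedSpace ℂ E]
    [NormedAddCommGroup E'] [NormedSpace ℂ E'] [NormedAddCommGroup G] [NormedSpace ℂ G]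
    [StarAddMonoid G] [StarModule ℂ G] [ContinuousStar G]
    (S : E →SL[starRingEnd ℂ] E') (L : E' →L[ℂ] G) : E →L[ℂ] G :=
  ((starL ℂ : G ≃L⋆[ℂ] G) : G →SL[starRingEnd ℂ] G).comp (L.comp S)

theorem conjComp_apply {E E' G : Type*} [NormedAddCommGroup E] [NormedSpace ℂ E]
    [NormedAddCommGroup E'] [NormedSpace ℂ E'] [NormedAddCommGroup G] [NormedSpace ℂ G]
    [StarAddMonoid G] [StarModule ℂ G] [ContinuousStar G]
    (S : E →SL[starRingEnd ℂ] E') (L : E' →L[ℂ] G) (v : E) :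
    conjComp S L v = star (L (S v)) := rfl

/-- The two conjugations cancel, so the derivative is complex linear again; boundedness of `S` and
`star` keeps the error term small. -/
theorem HasFDerivAt.conjComp {E E' G : Type*} [NormedAddCommGroup E] [NormedSpace ℂ E]
    [NormedAddCommGroup E'] [NormedSpace ℂ E'] [NormedAddCommGroup G] [NormedSpace ℂ G]
    [StarAddMonoid G] [StarModule ℂ G] [ContinuousStar G]
    (S : E →SL[starRingEnd ℂ] E') {F : E' → G} {L : E' →L[ℂ] G} {x : E}
    (h : HasFDerivAt F L (S x)) :
    HasFDerivAt (fun y => star (F (S y))) (conjComp S L) x := by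
  rw [hasFDerivAt_iff_isLittleO] at h ⊢
  have h1 := h.comp_tendsto (S.continuous.tendsto x)
  have hS : (fun y => S y - S x) =O[𝓝 x] fun y => y - x := by
    simpa using S.isBigO_sub (𝓝 x) x
  have h2 := h1.trans_isBigO hS
  have h3 := (((starL ℂ : G ≃L⋆[ℂ] G) : G →SL[starRingEnd ℂ] G).isBigO_comp
    (fun y => F (S y) - F (S x) - L (S y - S x)) (𝓝 x)).trans_isLittleO h2
  refine h3.congr_left fun y => ?_
  simp [conjComp_apply, map_sub]

/-! ### Holomorphic functions and the totally real subspace `χ = Z̄` -/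

section TotallyReal

variable {V : Type*} [NormedAddCommGroup V] [NormedSpace ℂ V] [StarAddMonoid V] [StarModule ℂ V]
  [ContinuousStar V]

/-- The conjugate-linear involution `(Z, χ) ↦ (χ̄, Z̄)`, whose fixed points are the `(Z, Z̄)`. -/
def conjSwap (V : Type*) [NormedAddCommGroup V] [NormedSpace ℂ V] [StarAddMonoid V]
    [StarModule ℂ V] [ContinuousStar V] : V × V →SL[starRingEnd ℂ] V × V where
  toFun p := (star p.2, star p.1)
  map_add' p q := by simp
  map_smul' c p := by simp
  cont := by fun_prop

@[simp]
theorem conjSwap_apply (p : V × V) : conjSwap V p = (star p.2, star p.1) := rfl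

/-- A function holomorphic near `0` that vanishes on the totally real subspace of the `(Z, Z̄)`
vanishes near `0`. -/
theorem eventually_eq_zero_of_totallyReal {F : V × V → ℂ}
    (hd : ∀ᶠ p in 𝓝 0, DifferentiableAt ℂ F p) (h0 : ∀ᶠ Z in 𝓝 (0 : V), F (Z, star Z) = 0) :
    ∀ᶠ p in 𝓝 0, F p = 0 := by
  have h0' : ∀ᶠ p : V × V in 𝓝 0, F (p.1, star p.1) = 0 :=
    (continuous_fst.tendsto (0 : V × V)).eventually h0
  obtain ⟨ε, hε, hball⟩ := Metric.eventually_nhds_iff_ball.1 (hd.and h0')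
  -- Real and imaginary parts for the involution: `p = (x, x̄) + i (y, ȳ)`. The complex line `l ↦
  -- (x, x̄) + l (y, ȳ)` is totally real for real `l` and reaches `p` at `l = i`; the bounds `ε / 3`
  -- keep it in the ball for `|l| < 2`.
  let x : V × V → V := fun p => (2⁻¹ : ℂ) • (p.1 + star p.2)
  let y : V × V → V := fun p => (2 * Complex.I)⁻¹ • (p.1 - star p.2)
  have hxc : Continuous fun p => (x p, star (x p)) := by fun_prop
  have hyc : Continuous fun p => (y p, star (y p)) := by fun_prop
  have hx : ∀ᶠ p : V × V in 𝓝 0, ‖(x p, star (x p))‖ < ε / 3 := by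
    have := hxc.norm.tendsto 0
    simp only [x, Prod.fst_zero, Prod.snd_zero, star_zero, add_zero, smul_zero, Prod.mk_zero_zero,
      norm_zero] at this
    exact this.eventually_lt_const (by positivity)
  have hy : ∀ᶠ p : V × V in 𝓝 0, ‖(y p, star (y p))‖ < ε / 3 := by
    have := hyc.norm.tendsto 0
    simp only [y, Prod.fst_zero, Prod.snd_zero, star_zero, sub_zero, smul_zero, Prod.mk_zero_zero,
      norm_zero] at this
    exact this.eventually_lt_const (by positivity)
  filter_upwards [hx, hy] with p hxp hyp
  have hmem : ∀ l : ℂ, l ∈ Metric.ball (0 : ℂ) 2 →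
      (x p, star (x p)) + l • (y p, star (y p)) ∈ Metric.ball (0 : V × V) ε := by
    intro l hl
    rw [mem_ball_zero_iff] at hl ⊢
    calc _ ≤ ‖(x p, star (x p))‖ + ‖l‖ * ‖(y p, star (y p))‖ := by
          rw [← norm_smul]; exact norm_add_le _ _
      _ ≤ ‖(x p, star (x p))‖ + 2 * ‖(y p, star (y p))‖ := by gcongr
      _ < ε := by linarith
  have han : AnalyticOnNhd ℂ (fun l : ℂ => F ((x p, star (x p)) + l • (y p, star (y p))))
      (Metric.ball 0 2) := by
    refine DifferentiableOn.analyticOnNhd (fun l hl => ?_) Metric.isOpen_ball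
    exact ((hball _ (hmem l hl)).1.comp l (by fun_prop)).differentiableWithinAt
  -- Real parameters accumulate at `0`, which suffices for the identity theorem in one variable.
  have hfreq : ∃ᶠ l : ℂ in 𝓝[≠] 0, F ((x p, star (x p)) + l • (y p, star (y p))) = 0 := by
    have ht : Filter.Tendsto (fun t : ℝ => (t : ℂ)) (𝓝[≠] 0) (𝓝[≠] 0) := by
      refine tendsto_nhdsWithin_of_tendsto_nhds_of_eventually_within _ ?_ ?_
      · exact (Complex.continuous_ofReal.tendsto' 0 0 (by simp)).mono_left nhdsWithin_le_nhds
      · filter_upwards [self_mem_nhdsWithin] with t ht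
        simpa using ht
    refine ht.frequently (Filter.Eventually.frequently ?_)
    have : ∀ᶠ t : ℝ in 𝓝 0, (t : ℂ) ∈ Metric.ball (0 : ℂ) 2 :=
      (Complex.continuous_ofReal.tendsto' 0 0 (by simp)).eventually
        (Metric.ball_mem_nhds (0 : ℂ) two_pos)
    filter_upwards [nhdsWithin_le_nhds this] with t ht
    have := (hball _ (hmem t ht)).2
    simpa using this
  have := han.eqOn_zero_of_preconnected_of_frequently_eq_zero
    (convex_ball (0 : ℂ) 2).isPreconnected (by simp) hfreq (x := Complex.I) (by simp)
  have hp : (x p, star (x p)) + Complex.I • (y p, star (y p)) = p := by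
    have h1 : Complex.I * (2 * Complex.I)⁻¹ = 2⁻¹ := by field_simp
    have h2 : Complex.I * (2 * -Complex.I)⁻¹ = -2⁻¹ := by
      rw [mul_neg, inv_neg, mul_neg, h1]
    ext1
    · simp only [x, y, Prod.fst_add, Prod.smul_fst, smul_smul, h1]
      rw [← smul_add, add_add_sub_cancel, ← two_smul ℂ, smul_smul]
      norm_num
    · simp only [x, y, Prod.snd_add, Prod.smul_snd, star_smul, star_add, star_sub, star_star,
        smul_smul, star_inv₀, star_mul']
      simp only [Complex.star_def, Complex.conj_I, map_ofNat, h2]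
      rw [neg_smul, ← sub_eq_add_neg, ← smul_sub, add_sub_sub_cancel, ← two_smul ℂ, smul_smul]
      norm_num
  have h : F ((x p, star (x p)) + Complex.I • (y p, star (y p))) = 0 := this
  rwa [hp] at h

/-- A holomorphic function which is real at the `(Z, Z̄)` is hermitian. -/
theorem eventually_hermitian_of_real {F : V × V → ℂ}
    (hd : ∀ᶠ p in 𝓝 0, DifferentiableAt ℂ F p)
    (hr : ∀ᶠ Z in 𝓝 (0 : V), (F (Z, star Z)).im = 0) :
    ∀ᶠ p : V × V in 𝓝 0, star (F (star p.2, star p.1)) = F p := by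
  have hs : ∀ᶠ p in 𝓝 0, DifferentiableAt ℂ F (conjSwap V p) :=
    ((conjSwap V).continuous.tendsto' 0 0 (map_zero _)).eventually hd
  have := eventually_eq_zero_of_totallyReal (F := fun p => star (F (conjSwap V p)) - F p) ?_ ?_
  · filter_upwards [this] with p hp
    exact sub_eq_zero.1 hp
  · filter_upwards [hd, hs] with p hp hsp
    exact (hsp.hasFDerivAt.conjComp _).differentiableAt.sub hp
  · filter_upwards [hr] with Z hZ
    simp [sub_eq_zero, Complex.conj_eq_iff_im, hZ]

/-- Differentiate the hermitian symmetry at `0`, a fixed point of the involution. -/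
theorem fderiv_conjSwap_of_real {F : V × V → ℂ}
    (hd : ∀ᶠ p in 𝓝 0, DifferentiableAt ℂ F p)
    (hr : ∀ᶠ Z in 𝓝 (0 : V), (F (Z, star Z)).im = 0) (p : V × V) :
    fderiv ℂ F 0 (star p.2, star p.1) = star (fderiv ℂ F 0 p) := by
  have h0 : HasFDerivAt F (fderiv ℂ F 0) (conjSwap V 0) := by
    rw [map_zero]; exact hd.self_of_nhds.hasFDerivAt
  have h1 := (h0.conjComp (conjSwap V)).congr_of_eventuallyEq
    ((eventually_hermitian_of_real hd hr).mono fun p hp => hp.symm)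
  have := DFunLike.congr_fun h1.fderiv p
  rw [conjComp_apply, conjSwap_apply] at this
  rw [this, star_star]

end TotallyReal

/-! ### Straightening a hypersurface -/

section Straightening

variable {X : Type*} [NormedAddCommGroup X] [NormedSpace ℂ X] [CompleteSpace X]

/-- Near a regular point, `r` becomes linear in a suitable chart, with inverse `ψ`. -/
theorem exists_straightening {r : X → ℂ} (hr : ContDiffAt ℂ 2 r 0) (hr0 : r 0 = 0) {e : X}
    (he : fderiv ℂ r 0 e = 1) :
    ∃ ψ : X → X, ContDiffAt ℂ 2 ψ 0 ∧ ψ 0 = 0 ∧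
      HasFDerivAt ψ (ContinuousLinearMap.id ℂ X) 0 ∧
      (∀ᶠ y in 𝓝 0, ψ y + (r (ψ y) - fderiv ℂ r 0 (ψ y)) • e = y) ∧
      (∀ᶠ x in 𝓝 0, ψ (x + (r x - fderiv ℂ r 0 x) • e) = x) ∧
      ∀ᶠ y in 𝓝 0, r (ψ y) = fderiv ℂ r 0 y := by
  -- Since `dr(e) = 1`, `dr(0) ∘ Φ = r`; since `Φ` has derivative the identity at `0`, the inverse
  -- function theorem provides `ψ`.
  let Φ : X → X := fun x => x + (r x - fderiv ℂ r 0 x) • e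
  have hΦ0 : Φ 0 = 0 := by simp [Φ, hr0]
  have hΦ : ContDiffAt ℂ 2 Φ 0 :=
    contDiffAt_id.add ((hr.sub (fderiv ℂ r 0).contDiff.contDiffAt).smul contDiffAt_const)
  have hΦ' : HasFDerivAt Φ ((ContinuousLinearEquiv.refl ℂ X : X ≃L[ℂ] X) : X →L[ℂ] X) 0 := by
    have h1 := (hr.differentiableAt two_ne_zero).hasFDerivAt
    have := (hasFDerivAt_id (𝕜 := ℂ) (0 : X)).add
      ((h1.sub (fderiv ℂ r 0).hasFDerivAt).smul_const e)
    refine this.congr_fderiv ?_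
    ext; simp
  have hs := hΦ.hasStrictFDerivAt' hΦ' two_ne_zero
  have hψ := hΦ.to_localInverse hΦ' two_ne_zero
  have hψ0 := hs.localInverse_apply_image
  have hψ' := hs.to_localInverse.hasFDerivAt
  have hright := hs.eventually_right_inverse
  have hleft := hs.eventually_left_inverse
  rw [hΦ0] at hψ hψ0 hψ' hright
  refine ⟨_, hψ, hψ0, hψ', hright, hleft, ?_⟩
  filter_upwards [hright] with y hy
  have := congrArg (fderiv ℂ r 0) hy
  simp only [map_add, map_smul, he, smul_eq_mul, mul_one, add_sub_cancel, Φ] at this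
  exact this

/-- If `q` vanishes on the hypersurface `r = 0`, then `dq = a dr` and `d²q = a d²r` on the tangent
space of the hypersurface. -/
theorem exists_multiplier_of_vanishing {r q : X → ℂ} (hr : ContDiffAt ℂ 2 r 0)
    (hq : ContDiffAt ℂ 2 q 0) (hr0 : r 0 = 0) {e : X} (he : fderiv ℂ r 0 e ≠ 0)
    (hv : ∀ᶠ x in 𝓝 0, r x = 0 → q x = 0) :
    ∃ a : ℂ, fderiv ℂ q 0 = a • fderiv ℂ r 0 ∧
      ∀ u v, fderiv ℂ r 0 u = 0 → fderiv ℂ r 0 v = 0 →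
        fderiv ℂ (fderiv ℂ q) 0 u v = a * fderiv ℂ (fderiv ℂ r) 0 u v := by
  set l := fderiv ℂ r 0 with hl
  set e' : X := (l e)⁻¹ • e with he'
  have hle : l e' = 1 := by simp [he', he]
  obtain ⟨ψ, hψ, hψ0, hψ', -, -, hrψ⟩ := exists_straightening hr hr0 hle
  -- The projection onto `ker l` along `e'`. Then `θ = ψ ∘ P` takes values in the hypersurface and
  -- has derivative `P` at `0`.
  let P : X →L[ℂ] X := ContinuousLinearMap.id ℂ X - l.smulRight e'
  have hP : ∀ y, l (P y) = 0 := fun y => by simp [P, hle]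
  have hPk : ∀ u, l u = 0 → P u = u := fun u hu => by simp [P, hu]
  have hP0 : Filter.Tendsto P (𝓝 0) (𝓝 0) := P.continuous.tendsto' 0 0 (map_zero P)
  let θ : X → X := fun y => ψ (P y)
  have hθ0 : θ 0 = 0 := by simp [θ, hψ0]
  have hθ : ContDiffAt ℂ 2 θ 0 :=
    ContDiffAt.comp (0 : X) (by simpa using hψ) P.contDiff.contDiffAt
  have hθ' : HasFDerivAt θ P 0 := by
    have : HasFDerivAt ψ (ContinuousLinearMap.id ℂ X) (P 0) := by simpa using hψ'
    have h := this.comp (0 : X) P.hasFDerivAt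
    rwa [ContinuousLinearMap.id_comp] at h
  have hθt : Filter.Tendsto θ (𝓝 0) (𝓝 0) := by simpa [hθ0] using hθ.continuousAt.tendsto
  have hqθ : ∀ᶠ y in 𝓝 0, q (θ y) = 0 := by
    filter_upwards [hP0.eventually hrψ, hθt.eventually hv] with y h1 h2
    exact h2 (by rw [h1, hP])
  have hrθ : ∀ᶠ y in 𝓝 0, r (θ y) = 0 := by
    filter_upwards [hP0.eventually hrψ] with y h1
    rw [h1, hP]
  have hq1 : fderiv ℂ q 0 = fderiv ℂ q 0 e' • l := by
    have hqd : HasFDerivAt q (fderiv ℂ q 0) (θ 0) := by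
      rw [hθ0]; exact (hq.differentiableAt two_ne_zero).hasFDerivAt
    have h1 := hqd.comp (0 : X) hθ'
    have h2 : HasFDerivAt (q ∘ θ) (0 : X →L[ℂ] ℂ) 0 :=
      (hasFDerivAt_const (0 : ℂ) (0 : X)).congr_of_eventuallyEq hqθ
    ext u
    have h3 := DFunLike.congr_fun (h1.unique h2) u
    simp only [ContinuousLinearMap.comp_apply, P, sub_apply,
      ContinuousLinearMap.id_apply, ContinuousLinearMap.smulRight_apply, map_sub, map_smul,
      zero_apply, smul_eq_mul, sub_eq_zero] at h3
    simp [h3, mul_comm]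
  refine ⟨fderiv ℂ q 0 e', hq1, fun u v hu hv => ?_⟩
  set a := fderiv ℂ q 0 e' with ha
  -- Subtracting `a r` makes `dk(0) = 0`, so the term with the second derivative of `θ` disappears
  -- when `k ∘ θ = 0` is differentiated twice at `0`.
  let k : X → ℂ := fun x => q x - a * r x
  have hk : ContDiffAt ℂ 2 k 0 := hq.sub (contDiffAt_const.mul hr)
  have hkd : ∀ᶠ x in 𝓝 0, HasFDerivAt k (fderiv ℂ q x - a • fderiv ℂ r x) x := by
    filter_upwards [hq.eventually (by simp), hr.eventually (by simp)] with x h1 h2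
    exact (h1.differentiableAt two_ne_zero).hasFDerivAt.sub
      ((h2.differentiableAt two_ne_zero).hasFDerivAt.const_mul a)
  have hq2 : HasFDerivAt (fderiv ℂ q) (fderiv ℂ (fderiv ℂ q) 0) 0 :=
    ((hq.fderiv_right (m := 1) (by norm_num)).differentiableAt one_ne_zero).hasFDerivAt
  have hr2 : HasFDerivAt (fderiv ℂ r) (fderiv ℂ (fderiv ℂ r) 0) 0 :=
    ((hr.fderiv_right (m := 1) (by norm_num)).differentiableAt one_ne_zero).hasFDerivAt
  have hk2 : HasFDerivAt (fun x => fderiv ℂ q x - a • fderiv ℂ r x)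
      (fderiv ℂ (fderiv ℂ q) 0 - a • fderiv ℂ (fderiv ℂ r) 0) (θ 0) := by
    rw [hθ0]; exact hq2.sub (hr2.const_smul a)
  have hθ2 : HasFDerivAt (fderiv ℂ θ) (fderiv ℂ (fderiv ℂ θ) 0) 0 :=
    ((hθ.fderiv_right (m := 1) (by norm_num)).differentiableAt one_ne_zero).hasFDerivAt
  have hzero : ∀ᶠ y in 𝓝 0,
      (fderiv ℂ q (θ y) - a • fderiv ℂ r (θ y)).comp (fderiv ℂ θ y) = 0 := by
    filter_upwards [hqθ.eventually_nhds, hrθ.eventually_nhds, hθt.eventually hkd,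
      hθ.eventually (by simp)] with y h1 h2 h3 h4
    have h5 := h3.comp y (h4.differentiableAt two_ne_zero).hasFDerivAt
    refine h5.unique ((hasFDerivAt_const (0 : ℂ) y).congr_of_eventuallyEq ?_)
    filter_upwards [h1, h2] with x hx1 hx2
    simp [k, hx1, hx2]
  have h6 := (hk2.comp (0 : X) hθ').clm_comp hθ2
  have h7 := h6.unique
    ((hasFDerivAt_const (0 : X →L[ℂ] ℂ) (0 : X)).congr_of_eventuallyEq hzero)
  have h8 := DFunLike.congr_fun (DFunLike.congr_fun h7 u) v
  have h9 : fderiv ℂ q 0 - a • fderiv ℂ r 0 = 0 := sub_eq_zero.2 hq1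
  simpa [hθ0, h9, hθ'.fderiv, hPk u hu, hPk v hv, sub_eq_zero] using h8

end Straightening

/-- If `ρ` is real and `ρ(Z, Z̄) = 0` implies `Q(Z, Z̄) = 0`, then `ρ(Z, χ) = 0` implies
`Q(Z, χ) = 0`. -/
theorem eventually_vanishing_of_totallyReal {V : Type*} [NormedAddCommGroup V] [NormedSpace ℂ V]
    [CompleteSpace V] [StarAddMonoid V] [StarModule ℂ V] [ContinuousStar V] {ρ Q : V × V → ℂ}
    (hρ : ContDiffAt ℂ 2 ρ 0) (hρ0 : ρ 0 = 0)
    (hr : ∀ᶠ Z in 𝓝 (0 : V), (ρ (Z, star Z)).im = 0) {v : V} (hv : fderiv ℂ ρ 0 (v, 0) ≠ 0)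
    (hQ : ∀ᶠ p in 𝓝 0, DifferentiableAt ℂ Q p)
    (hz : ∀ᶠ Z in 𝓝 (0 : V), ρ (Z, star Z) = 0 → Q (Z, star Z) = 0) :
    ∀ᶠ p in 𝓝 0, ρ p = 0 → Q p = 0 := by
  have hd : ∀ᶠ p in 𝓝 0, DifferentiableAt ℂ ρ p :=
    (hρ.eventually (by simp)).mono fun p hp => hp.differentiableAt two_ne_zero
  have hherm := eventually_hermitian_of_real hd hr
  have hdherm := fderiv_conjSwap_of_real hd hr
  set l := fderiv ℂ ρ 0 with hl
  -- Each half of `e = (e₁, ē₁)` contributes `1/2` to `l e = 1`, and `e` is fixed by the involution,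
  -- so the straightening along `e` respects conjugation.
  set e₁ : V := (2 * l (v, 0))⁻¹ • v with he₁
  have h1 : l (e₁, 0) = 2⁻¹ := by
    have : (e₁, (0 : V)) = (2 * l (v, 0))⁻¹ • (v, (0 : V)) := by simp [he₁]
    rw [this, map_smul, smul_eq_mul]
    field_simp
  have h2 : l (0, star e₁) = 2⁻¹ := by
    have := hdherm (e₁, 0)
    simpa [h1] using this
  set e : V × V := (e₁, star e₁) with he
  have hle : l e = 1 := by
    have : e = (e₁, 0) + (0, star e₁) := by simp [he]
    rw [this, map_add, h1, h2]; norm_num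
  have hσe : conjSwap V e = e := by simp [he]
  obtain ⟨ψ, hψ, hψ0, hψ', hright, hleft, hρψ⟩ := exists_straightening hρ hρ0 hle
  rw [← hl] at hright hleft hρψ
  have hψt : Filter.Tendsto ψ (𝓝 0) (𝓝 0) := by simpa [hψ0] using hψ.continuousAt.tendsto
  have hσt : Filter.Tendsto (conjSwap V) (𝓝 0) (𝓝 0) :=
    (conjSwap V).continuous.tendsto' 0 0 (map_zero _)
  let P : V × V →L[ℂ] V × V := ContinuousLinearMap.id ℂ _ - l.smulRight e
  have hPt : Filter.Tendsto P (𝓝 0) (𝓝 0) := P.continuous.tendsto' 0 0 (map_zero P)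
  -- `ψ` preserves the fixed points of the involution
  have hfix : ∀ᶠ p in 𝓝 0, conjSwap V p = p → conjSwap V (ψ p) = ψ p := by
    filter_upwards [hright, hψt.eventually hherm, hψt.eventually (hσt.eventually hleft)]
      with p hp1 hp2 hp3 hp
    have h3 : ρ (conjSwap V (ψ p)) = star (ρ (ψ p)) := by
      rw [← hp2, star_star]; rfl
    have h4 : l (conjSwap V (ψ p)) = star (l (ψ p)) := hdherm _
    rw [h3, h4] at hp3
    -- The chart inverse to `ψ` commutes with the involution, so it sends both `ψ p` and its
    -- conjugate to `p`; the left inverse identifies them.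
    have h5 : conjSwap V (ψ p) + (star (ρ (ψ p)) - star (l (ψ p))) • e = p := by
      conv_rhs => rw [← hp, ← hp1]
      rw [map_add, map_smulₛₗ, hσe]
      simp
    rw [h5] at hp3
    exact hp3.symm
  -- At points `(Z, Z̄)`, `ψ ∘ P` is again of this form and lies on `ρ = 0`, so the hypothesis on
  -- `Q` applies there.
  have hG := eventually_eq_zero_of_totallyReal (F := fun p => Q (ψ (P p))) ?_ ?_
  · have hx : Filter.Tendsto (fun p => p + (ρ p - l p) • e) (𝓝 0) (𝓝 0) := by
      have : ContinuousAt (fun p => p + (ρ p - l p) • e) 0 := by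
        have := hρ.continuousAt
        fun_prop
      simpa [ContinuousAt, hρ0] using this
    filter_upwards [hx.eventually hG, hleft] with p hp1 hp2 hp
    have h6 : P (p + (ρ p - l p) • e) = p + (ρ p - l p) • e := by
      simp [P, hp, hle]
    rwa [h6, hp2] at hp1
  · have hψd : ∀ᶠ p in 𝓝 0, DifferentiableAt ℂ ψ p :=
      (hψ.eventually (by simp)).mono fun p hp => hp.differentiableAt two_ne_zero
    filter_upwards [hPt.eventually hψd, hPt.eventually (hψt.eventually hQ)] with p h1 h2
    exact h2.comp p (h1.comp p P.differentiableAt)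
  · have hdiag : Filter.Tendsto (fun Z : V => (Z, star Z)) (𝓝 0) (𝓝 0) :=
      Continuous.tendsto' (by fun_prop) 0 0 (by simp)
    have hz' : ∀ᶠ p : V × V in 𝓝 0, ρ (p.1, star p.1) = 0 → Q (p.1, star p.1) = 0 :=
      (continuous_fst.tendsto (0 : V × V)).eventually hz
    filter_upwards [hdiag.eventually (hPt.eventually hfix), hdiag.eventually (hPt.eventually hρψ),
      hdiag.eventually (hPt.eventually (hψt.eventually hz'))] with Z h1 h2 h3
    have hlZ : star (l (Z, star Z)) = l (Z, star Z) := by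
      have := hdherm (Z, star Z)
      simpa using this.symm
    have h4 := h1 (by
      simp only [P, sub_apply, ContinuousLinearMap.id_apply,
        ContinuousLinearMap.smulRight_apply, map_sub, map_smulₛₗ, hσe]
      rw [conjSwap_apply, star_star]
      congr 2)
    have h5 : star (ψ (P (Z, star Z))).1 = (ψ (P (Z, star Z))).2 := congrArg Prod.snd h4
    rw [h5] at h3
    refine h3 ?_
    rw [Prod.mk.eta, h2]
    simp [P, hle]


/-! ### Derivatives of slices and of compositions with linear maps -/

section Slices

variable {V W : Type*} [NormedAddCommGroup V] [NormedSpace ℂ V] [NormedAddCommGroup W]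
  [NormedSpace ℂ W]

theorem hasFDerivAt_slice {ρ : V × W → ℂ} {Z : V} {χ : W} (h : DifferentiableAt ℂ ρ (Z, χ)) :
    HasFDerivAt (fun Z => ρ (Z, χ))
      ((fderiv ℂ ρ (Z, χ)).comp (ContinuousLinearMap.inl ℂ V W)) Z :=
  h.hasFDerivAt.comp Z (hasFDerivAt_prodMk_left Z χ)

theorem fderiv_slice_apply {ρ : V × W → ℂ} {Z : V} {χ : W} (h : DifferentiableAt ℂ ρ (Z, χ))
    (v : V) : fderiv ℂ (fun Z => ρ (Z, χ)) Z v = fderiv ℂ ρ (Z, χ) (v, 0) := by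
  rw [(hasFDerivAt_slice h).fderiv]; rfl

theorem analyticAt_slice {ρ : V × W → ℂ} {Z : V} {χ : W} (h : AnalyticAt ℂ ρ (Z, χ)) :
    AnalyticAt ℂ (fun Z => ρ (Z, χ)) Z :=
  h.comp_of_eq (analyticAt_id.prod analyticAt_const) rfl

theorem fderiv_fderiv_slice_apply {ρ : V × W → ℂ} {Z : V} {χ : W} (h : AnalyticAt ℂ ρ (Z, χ))
    (u v : V) : fderiv ℂ (fderiv ℂ fun Z => ρ (Z, χ)) Z u v =
      fderiv ℂ (fderiv ℂ ρ) (Z, χ) (u, 0) (v, 0) := by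
  have hc : Filter.Tendsto (fun Z' : V => (Z', χ)) (𝓝 Z) (𝓝 (Z, χ)) :=
    Continuous.tendsto (by fun_prop) Z
  have h1 : (fderiv ℂ fun Z => ρ (Z, χ)) =ᶠ[𝓝 Z] fun Z' =>
      (ContinuousLinearMap.compL ℂ V (V × W) ℂ).flip (ContinuousLinearMap.inl ℂ V W)
        (fderiv ℂ ρ (Z', χ)) := by
    filter_upwards [hc.eventually h.eventually_analyticAt] with Z' hZ'
    exact (hasFDerivAt_slice hZ'.differentiableAt).fderiv
  have h2 := (((ContinuousLinearMap.compL ℂ V (V × W) ℂ).flip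
    (ContinuousLinearMap.inl ℂ V W)).hasFDerivAt).comp Z
      (h.fderiv.differentiableAt.hasFDerivAt.comp Z (hasFDerivAt_prodMk_left Z χ))
  rw [h1.fderiv_eq]
  exact DFunLike.congr_fun (DFunLike.congr_fun h2.fderiv u) v

theorem fderiv_clm_comp_apply {h : V → W} {x : V} (hh : DifferentiableAt ℂ h x) (Λ : W →L[ℂ] ℂ)
    (c : ℂ) (v : V) : fderiv ℂ (fun Z => Λ (h Z) - c) x v = Λ (fderiv ℂ h x v) := by
  have := (Λ.hasFDerivAt.comp x hh.hasFDerivAt).sub_const c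
  exact DFunLike.congr_fun this.fderiv v

/-- The outer map is affine, so the second-order chain rule has no term quadratic in `dh`. -/
theorem fderiv_fderiv_clm_comp_apply {h : V → W} {x : V} (hh : ContDiffAt ℂ 2 h x)
    (Λ : W →L[ℂ] ℂ) (c : ℂ) (u v : V) :
    fderiv ℂ (fderiv ℂ fun Z => Λ (h Z) - c) x u v = Λ (fderiv ℂ (fderiv ℂ h) x u v) := by
  have h1 : (fderiv ℂ fun Z => Λ (h Z) - c) =ᶠ[𝓝 x] fun Z =>
      ContinuousLinearMap.compL ℂ V W ℂ Λ (fderiv ℂ h Z) := by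
    filter_upwards [hh.eventually (by simp)] with Z hZ
    exact ((Λ.hasFDerivAt.comp Z
      (hZ.differentiableAt two_ne_zero).hasFDerivAt).sub_const c).fderiv
  have hd : DifferentiableAt ℂ (fderiv ℂ h) x :=
    (hh.fderiv_right (m := 1) (by norm_num)).differentiableAt one_ne_zero
  have h2 := (ContinuousLinearMap.compL ℂ V W ℂ Λ).hasFDerivAt.comp x hd.hasFDerivAt
  rw [h1.fderiv_eq]
  exact DFunLike.congr_fun (DFunLike.congr_fun h2.fderiv u) v

end Slices

/-! ### Polarization of the equation of a hyperquadric -/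

/-- The linear part in `X` of the polarized equation
`(X.2 - ξ.2̄) / 2i = ∑ A j k X.1 j ξ.1 k̄` of a hyperquadric. -/
def quadricPolar {N : ℕ} (A : Matrix (Fin N) (Fin N) ℂ) (ξ : CSpace N) : CSpace N →L[ℂ] ℂ :=
  (2 * Complex.I)⁻¹ • ContinuousLinearMap.snd ℂ (Fin N → ℂ) ℂ -
    ∑ j, ∑ k, (A j k * star (ξ.1 k)) •
      (ContinuousLinearMap.proj j).comp (ContinuousLinearMap.fst ℂ (Fin N → ℂ) ℂ)

theorem quadricPolar_apply {N : ℕ} (A : Matrix (Fin N) (Fin N) ℂ) (ξ X : CSpace N) :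
    quadricPolar A ξ X =
      (2 * Complex.I)⁻¹ * X.2 - ∑ j, ∑ k, A j k * X.1 j * star (ξ.1 k) := by
  simp only [quadricPolar, sub_apply, smul_apply,
    sum_apply, ContinuousLinearMap.comp_apply, ContinuousLinearMap.coe_fst',
    ContinuousLinearMap.coe_snd', ContinuousLinearMap.proj_apply, smul_eq_mul]
  congr 1
  exact Finset.sum_congr rfl fun j _ => Finset.sum_congr rfl fun k _ => by ring

/-- The polarized equation of a hyperquadric. -/
def quadricEq {N : ℕ} (A : Matrix (Fin N) (Fin N) ℂ) (X ξ : CSpace N) : ℂ :=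
  quadricPolar A ξ X - (2 * Complex.I)⁻¹ * star ξ.2

theorem star_hermitianSum {N : ℕ} {A : Matrix (Fin N) (Fin N) ℂ} (hA : A.IsHermitian)
    (x y : Fin N → ℂ) :
    star (∑ j, ∑ k, A j k * x j * star (y k)) = ∑ j, ∑ k, A j k * y j * star (x k) := by
  simp only [star_sum, star_mul', star_star]
  rw [Finset.sum_comm]
  refine Finset.sum_congr rfl fun j _ => Finset.sum_congr rfl fun k _ => ?_
  rw [hA.apply j k]
  ring

theorem inv_two_I_mul_re (c : ℂ) : ((2 * Complex.I)⁻¹ * c).re = c.im / 2 := by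
  simp [Complex.mul_re, Complex.mul_im]
  ring

/-- `quadricFun` keeps only the real part of the form; hermitian symmetry makes the imaginary part
vanish. -/
theorem quadricEq_self_eq_zero {N : ℕ} {A : Matrix (Fin N) (Fin N) ℂ} (hA : A.IsHermitian)
    {T : CSpace N ≃L[ℂ] CSpace N} {X : CSpace N} (hX : quadricFun T A X = 0) :
    quadricEq A (T X) (T X) = 0 := by
  have h1 : (∑ j, ∑ k, A j k * (T X).1 j * star ((T X).1 k)).im = 0 :=
    Complex.conj_eq_iff_im.1 (star_hermitianSum hA _ _)
  have h2 : (2 * Complex.I)⁻¹ * (T X).2 - (2 * Complex.I)⁻¹ * star (T X).2 = (T X).2.im := by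
    rw [← mul_sub, Complex.star_def, Complex.sub_conj]
    push_cast
    field_simp
  rw [quadricEq, quadricPolar_apply, sub_right_comm, h2]
  rw [quadricFun] at hX
  apply Complex.ext
  · simpa using hX
  · rw [Complex.sub_im, Complex.ofReal_im, h1, sub_zero, Complex.zero_im]

/-- This carries real transversality over to the polarized equation. On the line `X + t u` the
function is a quadratic polynomial in `t`, and its linear coefficient is the derivative. -/
theorem fderiv_quadricFun {N : ℕ} {A : Matrix (Fin N) (Fin N) ℂ} (hA : A.IsHermitian)
    (T : CSpace N ≃L[ℂ] CSpace N) (X u : CSpace N) :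
    fderiv ℝ (quadricFun T A) X u = 2 * (quadricPolar A (T X) (T u)).re := by
  have hd : DifferentiableAt ℝ (quadricFun T A) X := by
    have hT : Differentiable ℝ T := (T.restrictScalars ℝ).differentiable
    have h1 : Differentiable ℝ fun Z => (T Z).1 := hT.fst
    have h2 : Differentiable ℝ fun Z => (T Z).2 := hT.snd
    have h3 : ∀ j, Differentiable ℝ fun Z => (T Z).1 j := fun j => differentiable_pi.1 h1 j
    have h4 : Differentiable ℝ fun Z => ∑ j, ∑ k, A j k * (T Z).1 j * star ((T Z).1 k) :=
      Differentiable.fun_sum fun j _ => Differentiable.fun_sum fun k _ =>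
        ((h3 j).const_mul _).mul (h3 k).star
    exact ((Complex.imCLM.differentiable.comp h2).sub
      (Complex.reCLM.differentiable.comp h4)).differentiableAt
  have hline : HasDerivAt (fun t : ℝ => X + t • u) u 0 := by
    simpa using ((hasDerivAt_id (0 : ℝ)).smul_const u).const_add X
  have h1 : HasDerivAt (fun t : ℝ => quadricFun T A (X + t • u))
      (fderiv ℝ (quadricFun T A) X u) 0 := by
    have : HasFDerivAt (quadricFun T A) (fderiv ℝ (quadricFun T A) X) (X + (0 : ℝ) • u) := by
      simpa using hd.hasFDerivAt
    exact this.comp_hasDerivAt (0 : ℝ) hline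
  set B : (Fin N → ℂ) → (Fin N → ℂ) → ℂ := fun x y => ∑ j, ∑ k, A j k * x j * star (y k) with hB
  have hBr : (B (T X).1 (T u).1).re = (B (T u).1 (T X).1).re := by
    have : star (B (T u).1 (T X).1) = B (T X).1 (T u).1 := star_hermitianSum hA _ _
    rw [← this, Complex.star_def, Complex.conj_re]
  have hpoly : ∀ t : ℝ, quadricFun T A (X + t • u) = quadricFun T A X +
      t * (2 * (quadricPolar A (T X) (T u)).re) - t ^ 2 * (B (T u).1 (T u).1).re := by
    intro t
    have hT : T (X + t • u) = T X + (t : ℂ) • T u := by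
      rw [map_add, ← Complex.coe_smul, map_smul]
    have hBadd : B (T X + (t : ℂ) • T u).1 (T X + (t : ℂ) • T u).1 = B (T X).1 (T X).1 +
        t * B (T u).1 (T X).1 + t * B (T X).1 (T u).1 + t ^ 2 * B (T u).1 (T u).1 := by
      simp only [hB, Finset.mul_sum, ← Finset.sum_add_distrib]
      refine Finset.sum_congr rfl fun j _ => Finset.sum_congr rfl fun k _ => ?_
      simp only [Prod.fst_add, Prod.smul_fst, Pi.add_apply, Pi.smul_apply, smul_eq_mul, star_add,
        star_mul', Complex.star_def, Complex.conj_ofReal]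
      ring
    have hre : (quadricPolar A (T X) (T u)).re = (T u).2.im / 2 - (B (T u).1 (T X).1).re := by
      rw [quadricPolar_apply, Complex.sub_re, inv_two_I_mul_re]
    have hq : ∀ Y, quadricFun T A Y = (T Y).2.im - (B (T Y).1 (T Y).1).re := fun Y => rfl
    rw [hq, hq, hT, hBadd, hre]
    simp only [Complex.add_re, Complex.re_ofReal_mul, Prod.snd_add, Prod.smul_snd, smul_eq_mul,
      Complex.add_im, Complex.im_ofReal_mul, ← Complex.ofReal_pow, hBr]
    ring
  have h2 : HasDerivAt (fun t : ℝ => quadricFun T A (X + t • u))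
      (2 * (quadricPolar A (T X) (T u)).re) 0 := by
    simp only [hpoly]
    have h3 := ((hasDerivAt_id (0 : ℝ)).mul_const (2 * (quadricPolar A (T X) (T u)).re)).const_add
      (quadricFun T A X)
    have h4 := ((hasDerivAt_id (0 : ℝ)).pow 2).mul_const (B (T u).1 (T u).1).re
    refine (h3.sub h4).congr_deriv ?_
    simp
  exact h1.unique h2

/-- Transversality to the hyperquadric, in terms of the polarized equation. -/
theorem exists_quadricPolar_ne_zero {V : Type*} [NormedAddCommGroup V] [NormedSpace ℂ V] {N : ℕ}
    {A : Matrix (Fin N) (Fin N) ℂ} (hA : A.IsHermitian) (T : CSpace N ≃L[ℂ] CSpace N)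
    {X : CSpace N} {D : V →L[ℂ] CSpace N}
    (ht : ∀ u : CSpace N, ∃ (v : V) (t : CSpace N),
      fderiv ℝ (quadricFun T A) X t = 0 ∧ u = D v + t) :
    ∃ v, quadricPolar A (T X) (T (D v)) ≠ 0 := by
  by_contra! hcon
  -- In this direction `Im w` grows at rate `1` and the hermitian form contributes nothing to the
  -- derivative.
  obtain ⟨v, t, ht0, hu⟩ := ht (T.symm (0, Complex.I))
  have h1 := congrArg (fderiv ℝ (quadricFun T A) X) hu
  rw [map_add, ht0, fderiv_quadricFun hA, fderiv_quadricFun hA, hcon v,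
    ContinuousLinearEquiv.apply_symm_apply, quadricPolar_apply, Complex.sub_re,
    inv_two_I_mul_re] at h1
  norm_num at h1

theorem continuous_quadricPolar_apply {N : ℕ} (A : Matrix (Fin N) (Fin N) ℂ) (X : CSpace N) :
    Continuous fun ξ : CSpace N => quadricPolar A ξ X := by
  simp only [quadricPolar_apply]
  fun_prop

/-! ### Segre varieties and the hyperplanes containing their images -/

section Multiplier

variable {V : Type*} [NormedAddCommGroup V] [NormedSpace ℂ V] [StarAddMonoid V] [StarModule ℂ V]
  [ContinuousStar V]

/-- The equation is conjugate-holomorphic in its second point, which the substitution `star p.2`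
corrects. -/
theorem eventually_differentiableAt_quadricEq {N : ℕ} (A : Matrix (Fin N) (Fin N) ℂ)
    {h : V → CSpace N} (hh : ∀ᶠ Z in 𝓝 0, DifferentiableAt ℂ h Z) :
    ∀ᶠ p : V × V in 𝓝 0, DifferentiableAt ℂ (fun p => quadricEq A (h p.1) (h (star p.2))) p := by
  have h1 : Filter.Tendsto (fun p : V × V => p.1) (𝓝 0) (𝓝 0) :=
    Continuous.tendsto' (by fun_prop) 0 0 (by simp)
  have h2 : Filter.Tendsto (fun p : V × V => star p.2) (𝓝 0) (𝓝 0) :=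
    Continuous.tendsto' (by fun_prop) 0 0 (by simp)
  filter_upwards [h1.eventually hh, h2.eventually hh] with p hp1 hp2
  have hd1 : DifferentiableAt ℂ (fun p : V × V => h p.1) p := hp1.comp p differentiableAt_fst
  have hd2 : DifferentiableAt ℂ (fun p : V × V => star (h (star p.2))) p := by
    have := (hp2.hasFDerivAt.conjComp ((starL ℂ : V ≃L⋆[ℂ] V) : V →SL[starRingEnd ℂ] V)
      (x := p.2)).differentiableAt
    exact this.comp p differentiableAt_snd
  have e1 : ∀ j, DifferentiableAt ℂ (fun p : V × V => (h p.1).1 j) p := fun j =>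
    differentiableAt_pi.1 hd1.fst j
  have e2 : ∀ j, DifferentiableAt ℂ (fun p : V × V => star ((h (star p.2)).1 j)) p := fun j =>
    differentiableAt_pi.1 hd2.fst j
  have e3 : DifferentiableAt ℂ (fun p : V × V => star (h (star p.2)).2) p := hd2.snd
  simp only [quadricEq, quadricPolar_apply]
  exact ((hd1.snd.const_mul _).sub (DifferentiableAt.fun_sum fun j _ =>
    DifferentiableAt.fun_sum fun k _ => ((e1 j).const_mul _).mul (e2 k))).sub (e3.const_mul _)

variable [CompleteSpace V]

/-- Let `h` map the hypersurface `ρ = 0` transversally into a hyperquadric. For `ζ` near `0` on the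
Segre variety of `0`, the first derivatives of the Segre variety of `ζ`, and its second
derivatives along tangent vectors, agree up to a factor with those of the pullback of the
hyperplane which is the Segre variety of `h ζ`. -/
theorem eventually_exists_multiplier {N : ℕ} {A : Matrix (Fin N) (Fin N) ℂ} {ρ : V × V → ℂ}
    (hρ : AnalyticAt ℂ ρ 0) (hρ0 : ρ 0 = 0)
    (hr : ∀ᶠ Z in 𝓝 (0 : V), (ρ (Z, star Z)).im = 0) {v : V} (hv : fderiv ℂ ρ 0 (v, 0) ≠ 0)
    {h : V → CSpace N} (hh : AnalyticAt ℂ h 0)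
    (hz : ∀ᶠ Z in 𝓝 (0 : V), ρ (Z, star Z) = 0 → quadricEq A (h Z) (h Z) = 0)
    (ht : ∃ v, quadricPolar A (h 0) (fderiv ℂ h 0 v) ≠ 0) :
    ∀ᶠ ζ in 𝓝 (0 : V), ρ (ζ, 0) = 0 → ∃ a : ℂ, a ≠ 0 ∧
      (∀ u, quadricPolar A (h ζ) (fderiv ℂ h 0 u) = a * fderiv ℂ ρ (0, star ζ) (u, 0)) ∧
      ∀ u v, fderiv ℂ ρ (0, star ζ) (u, 0) = 0 → fderiv ℂ ρ (0, star ζ) (v, 0) = 0 →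
        quadricPolar A (h ζ) (fderiv ℂ (fderiv ℂ h) 0 u v) =
          a * fderiv ℂ (fderiv ℂ ρ) (0, star ζ) (u, 0) (v, 0) := by
  have hcd : ContDiffAt ℂ 2 ρ 0 := hρ.contDiffAt
  have hd : ∀ᶠ p in 𝓝 0, DifferentiableAt ℂ ρ p :=
    hρ.eventually_analyticAt.mono fun p hp => hp.differentiableAt
  have hhd : ∀ᶠ Z in 𝓝 0, DifferentiableAt ℂ h Z :=
    hh.eventually_analyticAt.mono fun p hp => hp.differentiableAt
  have hherm := eventually_hermitian_of_real hd hr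
  have hvan := eventually_vanishing_of_totallyReal hcd hρ0 hr hv
    (eventually_differentiableAt_quadricEq A hhd) (by simpa using hz)
  obtain ⟨v', hv'⟩ := ht
  have hne1 : ∀ᶠ ζ in 𝓝 (0 : V), quadricPolar A (h ζ) (fderiv ℂ h 0 v') ≠ 0 :=
    ((continuous_quadricPolar_apply A _).continuousAt.comp hh.continuousAt).eventually_ne hv'
  have hs : Filter.Tendsto (fun ζ : V => ((0 : V), star ζ)) (𝓝 0) (𝓝 0) :=
    Continuous.tendsto' (by fun_prop) 0 0 (by simp)
  have hne2 : ∀ᶠ ζ in 𝓝 (0 : V), fderiv ℂ ρ (0, star ζ) (v, 0) ≠ 0 := by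
    have h1 : ContinuousAt (fun p => fderiv ℂ ρ p (v, 0)) 0 :=
      hρ.fderiv.continuousAt.clm_apply continuousAt_const
    exact hs.eventually (h1.eventually_ne hv)
  filter_upwards [hne1, hne2, hs.eventually hherm, hs.eventually hρ.eventually_analyticAt,
    hs.eventually hvan.eventually_nhds] with ζ h1 h2 h3 h4 h5 h6
  -- Symmetry of Segre varieties: `ζ ∈ S₀` gives `0 ∈ S_ζ`.
  have hr0 : ρ (0, star ζ) = 0 := by
    rw [← h3]
    simp [h6]
  have h7 : ∀ᶠ Z in 𝓝 (0 : V), ρ (Z, star ζ) = 0 →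
      quadricPolar A (h ζ) (h Z) - (2 * Complex.I)⁻¹ * star (h ζ).2 = 0 := by
    have : Filter.Tendsto (fun Z : V => (Z, star ζ)) (𝓝 0) (𝓝 (0, star ζ)) :=
      Continuous.tendsto (by fun_prop) 0
    filter_upwards [this.eventually h5] with Z hZ
    simpa [quadricEq] using hZ
  have hq : ContDiffAt ℂ 2
      (fun Z => quadricPolar A (h ζ) (h Z) - (2 * Complex.I)⁻¹ * star (h ζ).2) 0 :=
    (((quadricPolar A (h ζ)).contDiff.contDiffAt).comp (0 : V) hh.contDiffAt).sub contDiffAt_const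
  obtain ⟨a, ha1, ha2⟩ := exists_multiplier_of_vanishing (analyticAt_slice h4).contDiffAt hq hr0
    (e := v) (by rwa [fderiv_slice_apply h4.differentiableAt]) h7
  have ha1' : ∀ u, quadricPolar A (h ζ) (fderiv ℂ h 0 u) = a * fderiv ℂ ρ (0, star ζ) (u, 0) := by
    intro u
    have := DFunLike.congr_fun ha1 u
    rwa [fderiv_clm_comp_apply hh.differentiableAt, smul_apply,
      fderiv_slice_apply h4.differentiableAt, smul_eq_mul] at this
  refine ⟨a, ?_, ha1', fun u v hu hv => ?_⟩
  -- With `a = 0` the polar form would kill the range of `dh(0)`; transversality excludes this at `ζ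
  -- = 0`, hence by continuity nearby.
  · rintro rfl
    exact h1 (by rw [ha1', zero_mul])
  · have := ha2 u v (by rwa [fderiv_slice_apply h4.differentiableAt])
      (by rwa [fderiv_slice_apply h4.differentiableAt])
    rwa [fderiv_fderiv_clm_comp_apply hh.contDiffAt, fderiv_fderiv_slice_apply h4] at this

end Multiplier

/-! ### Linear relations between second derivatives -/

/-- If `D` is injective with values in a space of dimension at most `dim V + m`, then `m + 1`
vectors are linearly dependent modulo the range of `D`. -/
theorem exists_relation_modulo_range {K V W : Type*} [Field K] [AddCommGroup V] [Module K V]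
    [AddCommGroup W] [Module K W] [FiniteDimensional K V] [FiniteDimensional K W] {m : ℕ}
    {D : V →ₗ[K] W} (hD : Function.Injective D)
    (hdim : Module.finrank K W ≤ Module.finrank K V + m) (b : Fin (m + 1) → W) :
    ∃ (c : Fin (m + 1) → K) (w : V), c ≠ 0 ∧ ∑ j, c j • b j + D w = 0 := by
  have h1 : ¬ LinearIndependent K fun j => D.range.mkQ (b j) := by
    intro hli
    have h2 := hli.fintype_card_le_finrank
    have h3 := D.range.finrank_quotient_add_finrank
    rw [LinearMap.finrank_range_of_inj hD] at h3
    rw [Fintype.card_fin] at h2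
    omega
  obtain ⟨c, hc, i, hi⟩ := Fintype.not_linearIndependent_iff.1 h1
  have h4 : D.range.mkQ (∑ j, c j • b j) = 0 := by simpa using hc
  rw [Submodule.mkQ_apply, Submodule.Quotient.mk_eq_zero] at h4
  obtain ⟨w, hw⟩ := h4
  exact ⟨c, -w, fun h => hi (by simp [h]), by simp [hw]⟩


/-! ### Identity theorem on complex submanifolds -/

/-- A real-analytic function on a connected complex submanifold which vanishes near one point
vanishes identically. -/
theorem IsComplexSubmanifold.eqOn_zero {n : ℕ} {A : Set (CSpace n)} (hA : IsComplexSubmanifold A)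
    (hconn : IsConnected A) {K : CSpace n → ℂ} (hK : ∀ a ∈ A, AnalyticAt ℝ K a)
    {a₀ : CSpace n} (ha₀ : a₀ ∈ A) (h0 : ∀ᶠ ζ in 𝓝 a₀, ζ ∈ A → K ζ = 0) :
    ∀ a ∈ A, K a = 0 := by
  set U : Set (CSpace n) := {a | ∀ᶠ ζ in 𝓝 a, ζ ∈ A → K ζ = 0} with hU
  have hUo : IsOpen U := isOpen_setOfPred_eventually_nhds
  let S : Set A := (↑) ⁻¹' U
  have : PreconnectedSpace A := isPreconnected_iff_preconnectedSpace.1 hconn.isPreconnected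
  -- Near a limit point `a`, a chart turns `A` into a ball in `L`, which is convex. It contains the
  -- image of a nearby point `b` of `S`, so the identity theorem spreads the vanishing from `b` over
  -- the ball.
  have hclosed : IsClosed S := by
    refine isClosed_of_closure_subset fun a ha => ?_
    obtain ⟨φ, L, haφ, hφ, hφs, hAL⟩ := hA a a.2
    obtain ⟨ε, hε, hball⟩ := Metric.mem_nhds_iff.1
      (φ.open_target.mem_nhds (φ.map_source haφ))
    set O : Set (CSpace n) := φ.source ∩ φ ⁻¹' Metric.ball (φ a) ε with hO
    have hOo : IsOpen O := φ.continuousOn.isOpen_inter_preimage φ.open_source Metric.isOpen_ball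
    have haO : (a : CSpace n) ∈ O := ⟨haφ, Metric.mem_ball_self hε⟩
    obtain ⟨b, hbO, hbS⟩ := mem_closure_iff.1 ha _ (hOo.preimage continuous_subtype_val) haO
    let D : Set L := {y | (y : CSpace n) ∈ Metric.ball (φ a) ε}
    have hDc : IsPreconnected D :=
      ((convex_ball (φ a) ε).is_linear_preimage
        (L.subtype.restrictScalars ℝ).isLinear).isPreconnected
    have hmem : ∀ y ∈ D, φ.symm y ∈ A := fun y hy =>
      (hAL _ (φ.map_target (hball hy))).2 (by rw [φ.right_inv (hball hy)]; exact y.2)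
    have hG : AnalyticOnNhd ℝ (fun y : L => K (φ.symm y)) D := by
      intro y hy
      have h1 : AnalyticAt ℝ (fun y : L => (y : CSpace n)) y :=
        (L.subtypeL.restrictScalars ℝ).analyticAt y
      have h2 : AnalyticAt ℝ φ.symm (y : CSpace n) := (hφs _ (hball hy)).restrictScalars
      exact (hK _ (hmem y hy)).comp_of_eq (h2.comp_of_eq h1 rfl) rfl
    have hbL : φ b ∈ L := (hAL _ hbO.1).1 b.2
    have hev : (fun y : L => K (φ.symm y)) =ᶠ[𝓝 (⟨φ b, hbL⟩ : L)] 0 := by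
      have h1 : Filter.Tendsto (fun y : L => φ.symm y) (𝓝 (⟨φ b, hbL⟩ : L)) (𝓝 (b : CSpace n)) := by
        have h2 : ContinuousAt φ.symm (φ b) := φ.continuousAt_symm (φ.map_source hbO.1)
        have h3 : Filter.Tendsto φ.symm (𝓝 (φ b)) (𝓝 (b : CSpace n)) := by
          simpa [ContinuousAt, φ.left_inv hbO.1] using h2
        exact h3.comp (continuous_subtype_val.tendsto (⟨φ b, hbL⟩ : L))
      have hDo : IsOpen D := Metric.isOpen_ball.preimage continuous_subtype_val
      filter_upwards [h1.eventually hbS, hDo.mem_nhds (show (⟨φ b, hbL⟩ : L) ∈ D from hbO.2)]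
        with y hy hyD
      exact hy (hmem y hyD)
    have hzero := hG.eqOn_zero_of_preconnected_of_eventuallyEq_zero hDc
      (show (⟨φ b, hbL⟩ : L) ∈ D from hbO.2) hev
    change ∀ᶠ ζ in 𝓝 (a : CSpace n), ζ ∈ A → K ζ = 0
    filter_upwards [hOo.mem_nhds haO] with ζ hζ hζA
    have h1 := hzero (show (⟨φ ζ, (hAL _ hζ.1).1 hζA⟩ : L) ∈ D from hζ.2)
    simpa [φ.left_inv hζ.1] using h1
  have huniv : S = Set.univ :=
    IsClopen.eq_univ ⟨hclosed, hUo.preimage continuous_subtype_val⟩ ⟨⟨a₀, ha₀⟩, h0⟩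
  intro a ha
  have h1 : (⟨a, ha⟩ : A) ∈ S := huniv ▸ Set.mem_univ _
  exact (show ∀ᶠ ζ in 𝓝 a, ζ ∈ A → K ζ = 0 from h1).self_of_nhds ha

/-! ### Iterated partial derivatives -/

/-- The coordinate vector of `z_i`. -/
def zDir {n : ℕ} (i : Fin n) : CSpace n := (Pi.single i 1, 0)

/-- The coordinate vector of `w`. -/
def wDir {n : ℕ} : CSpace n := (0, 1)

theorem foldr_partialZ_of_sum_eq_zero {n : ℕ} {β : Fin n → ℕ} {l : List (Fin n)}
    (h : (l.map β).sum = 0) (f : CSpace n → ℂ) :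
    l.foldr (fun j g => (partialZ j)^[β j] g) f = f := by
  induction l with
  | nil => rfl
  | cons a t ih =>
    rw [List.map_cons, List.sum_cons] at h
    rw [List.foldr_cons, ih (by omega), show β a = 0 by omega]
    rfl

theorem exists_foldr_partialZ_of_sum_eq_one {n : ℕ} {β : Fin n → ℕ} {l : List (Fin n)}
    (h : (l.map β).sum = 1) : ∃ i, β i ≠ 0 ∧ ∀ f : CSpace n → ℂ,
      l.foldr (fun j g => (partialZ j)^[β j] g) f = partialZ i f := by
  induction l with
  | nil => simp at h
  | cons a t ih =>
    rw [List.map_cons, List.sum_cons] at h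
    obtain h0 | h1 : β a = 0 ∨ β a = 1 := by omega
    · obtain ⟨i, hi, hf⟩ := ih (by omega)
      exact ⟨i, hi, fun f => by rw [List.foldr_cons, hf, h0]; rfl⟩
    · refine ⟨a, by omega, fun f => ?_⟩
      rw [List.foldr_cons, foldr_partialZ_of_sum_eq_zero (by omega), h1]
      rfl

/-- The directions may coincide. That `β` is nonzero at both is kept in order to place them in `I`.
-/
theorem exists_foldr_partialZ_of_sum_eq_two {n : ℕ} {β : Fin n → ℕ} {l : List (Fin n)}
    (h : (l.map β).sum = 2) : ∃ i k, β i ≠ 0 ∧ β k ≠ 0 ∧ ∀ f : CSpace n → ℂ,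
      l.foldr (fun j g => (partialZ j)^[β j] g) f = partialZ i (partialZ k f) := by
  induction l with
  | nil => simp at h
  | cons a t ih =>
    rw [List.map_cons, List.sum_cons] at h
    obtain h0 | h1 | h2 : β a = 0 ∨ β a = 1 ∨ β a = 2 := by omega
    · obtain ⟨i, k, hi, hk, hf⟩ := ih (by omega)
      exact ⟨i, k, hi, hk, fun f => by rw [List.foldr_cons, hf, h0]; rfl⟩
    · obtain ⟨k, hk, hf⟩ := exists_foldr_partialZ_of_sum_eq_one (l := t) (β := β) (by omega)
      exact ⟨a, k, by omega, hk, fun f => by rw [List.foldr_cons, hf, h1]; rfl⟩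
    · refine ⟨a, a, by omega, by omega, fun f => ?_⟩
      rw [List.foldr_cons, foldr_partialZ_of_sum_eq_zero (by omega), h2]
      rfl

theorem mixedPartial_zero {n : ℕ} (s : ℕ) (f : CSpace n → ℂ) :
    mixedPartial 0 s f = partialW^[s] f :=
  foldr_partialZ_of_sum_eq_zero (by rw [← Fin.sum_univ_def]; simp) _

theorem mixedPartial_single {n : ℕ} (i : Fin n) (s : ℕ) (f : CSpace n → ℂ) :
    mixedPartial (Pi.single i 1) s f = partialZ i (partialW^[s] f) := by
  obtain ⟨k, hk, hf⟩ := exists_foldr_partialZ_of_sum_eq_one (β := Pi.single i 1)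
    (l := List.finRange n) (by rw [← Fin.sum_univ_def]; simp)
  obtain rfl : k = i := by
    by_contra hne
    exact hk (by simp [hne])
  exact hf _

theorem exists_mixedPartial_eq_of_sum_eq_two {n : ℕ} {α : Fin n → ℕ} (h : ∑ i, α i = 2) :
    ∃ i k, α i ≠ 0 ∧ α k ≠ 0 ∧ ∀ f : CSpace n → ℂ,
      mixedPartial α 0 f = partialZ i (partialZ k f) := by
  rw [Fin.sum_univ_def] at h
  obtain ⟨i, k, hi, hk, hf⟩ := exists_foldr_partialZ_of_sum_eq_two h
  exact ⟨i, k, hi, hk, fun f => hf f⟩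

theorem fderiv_fderiv_apply {E : Type*} [NormedAddCommGroup E] [NormedSpace ℂ E] {f : E → ℂ}
    {x : E} (hf : AnalyticAt ℂ f x) (u v : E) :
    fderiv ℂ (fun Z => fderiv ℂ f Z v) x u = fderiv ℂ (fderiv ℂ f) x u v := by
  rw [(hf.fderiv.differentiableAt.hasFDerivAt.clm_apply (hasFDerivAt_const v x)).fderiv]
  simp

section RhoDeriv

variable {n : ℕ} {ρ : CSpace n × CSpace n → ℂ} {ζ : CSpace n}

theorem rhoDeriv_w (h : AnalyticAt ℂ ρ (0, star ζ)) :
    rhoDeriv ρ 0 1 ζ = fderiv ℂ ρ (0, star ζ) (wDir, 0) := by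
  rw [← fderiv_slice_apply h.differentiableAt, rhoDeriv, mixedPartial_zero]
  rfl

theorem rhoDeriv_z (h : AnalyticAt ℂ ρ (0, star ζ)) (i : Fin n) :
    rhoDeriv ρ (Pi.single i 1) 0 ζ = fderiv ℂ ρ (0, star ζ) (zDir i, 0) := by
  rw [← fderiv_slice_apply h.differentiableAt, rhoDeriv, mixedPartial_single]
  rfl

theorem rhoDeriv_zw (h : AnalyticAt ℂ ρ (0, star ζ)) (i : Fin n) :
    rhoDeriv ρ (Pi.single i 1) 1 ζ =
      fderiv ℂ (fderiv ℂ ρ) (0, star ζ) (zDir i, 0) (wDir, 0) := by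
  rw [← fderiv_fderiv_slice_apply h, rhoDeriv, mixedPartial_single]
  exact fderiv_fderiv_apply (analyticAt_slice h) _ _

theorem rhoDeriv_ww (h : AnalyticAt ℂ ρ (0, star ζ)) :
    rhoDeriv ρ 0 2 ζ = fderiv ℂ (fderiv ℂ ρ) (0, star ζ) (wDir, 0) (wDir, 0) := by
  rw [← fderiv_fderiv_slice_apply h, rhoDeriv, mixedPartial_zero]
  exact fderiv_fderiv_apply (analyticAt_slice h) _ _

/-- The pair is chosen before `ρ` and `ζ`, so the same directions serve for all `ζ`. -/
theorem exists_rhoDeriv_of_sum_eq_two {α : Fin n → ℕ} (hα : ∑ i, α i = 2) :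
    ∃ i k, α i ≠ 0 ∧ α k ≠ 0 ∧ ∀ (ρ : CSpace n × CSpace n → ℂ) (ζ : CSpace n),
      AnalyticAt ℂ ρ (0, star ζ) → rhoDeriv ρ α 0 ζ =
        fderiv ℂ (fderiv ℂ ρ) (0, star ζ) (zDir i, 0) (zDir k, 0) := by
  obtain ⟨i, k, hi, hk, hf⟩ := exists_mixedPartial_eq_of_sum_eq_two hα
  refine ⟨i, k, hi, hk, fun ρ ζ h => ?_⟩
  rw [← fderiv_fderiv_slice_apply h, rhoDeriv, hf]
  exact fderiv_fderiv_apply (analyticAt_slice h) _ _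

end RhoDeriv

/-! ### The affine relation -/

/-- The tangent direction `∂/∂z_i - s_i ∂/∂w`. -/
def tangentDir {n : ℕ} (s : Fin n → ℂ) (i : Fin n) : CSpace n := zDir i - s i • wDir

/-- The affine polynomial whose value is the right-hand side of the relation expressing that
`∑ c_j L_{i_j} L_{k_j} ρ + dρ(v) = 0`, where `L_i = ∂/∂z_i - s_i ∂/∂w`. -/
def relationPoly {n m : ℕ} (s : Fin n → ℂ) (i k : Fin (m + 1) → Fin n) (c : Fin (m + 1) → ℂ)
    (v : CSpace n) : MvPolynomial (RelVar n) ℂ :=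
  ∑ j, c j • (s (k j) • MvPolynomial.X (RelVar.zw (Pi.single (i j) 1) (by simp)) +
      s (i j) • MvPolynomial.X (RelVar.zw (Pi.single (k j) 1) (by simp)) -
      (s (i j) * s (k j)) • MvPolynomial.X RelVar.ww) -
    (∑ l, v.1 l • MvPolynomial.X (RelVar.z (Pi.single l 1) (by simp)) + MvPolynomial.C v.2)

theorem totalDegree_relationPoly_le {n m : ℕ} (s : Fin n → ℂ) (i k : Fin (m + 1) → Fin n)
    (c : Fin (m + 1) → ℂ) (v : CSpace n) : (relationPoly s i k c v).totalDegree ≤ 1 := by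
  rw [← MvPolynomial.mem_restrictTotalDegree]
  have hX : ∀ x : RelVar n,
      (MvPolynomial.X x : MvPolynomial (RelVar n) ℂ) ∈ MvPolynomial.restrictTotalDegree _ ℂ 1 :=
    fun x => (MvPolynomial.mem_restrictTotalDegree _ _ _).2 (MvPolynomial.totalDegree_X x).le
  have hC : (MvPolynomial.C v.2 : MvPolynomial (RelVar n) ℂ) ∈
      MvPolynomial.restrictTotalDegree _ ℂ 1 :=
    (MvPolynomial.mem_restrictTotalDegree _ _ _).2 (by simp)
  refine Submodule.sub_mem _ (Submodule.sum_mem _ fun j _ => Submodule.smul_mem _ _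
    (Submodule.sub_mem _ (Submodule.add_mem _ ?_ ?_) ?_)) (Submodule.add_mem _
    (Submodule.sum_mem _ fun l _ => ?_) hC)
  all_goals exact Submodule.smul_mem _ _ (hX _)

theorem eq_sum_zDir_add_wDir {n : ℕ} (v : CSpace n) :
    v = ∑ l, v.1 l • zDir l + v.2 • wDir := by
  ext1
  · have h : ∑ l, v.1 l • (Pi.single l 1 : Fin n → ℂ) = v.1 := by
      ext x; simp [Finset.sum_apply, Pi.single_apply]
    simp [zDir, wDir, Prod.fst_sum, h]
  · simp [zDir, wDir, Prod.snd_sum]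

/-- The coefficients `s` are constant, so the second derivatives expand bilinearly without
first-order terms. Division by `ρ_w` turns the `w`-part of `dρ(v)` into the constant `v.2`. -/
theorem relationAt_relationPoly {n m : ℕ} {ρ : CSpace n × CSpace n → ℂ} {ζ : CSpace n}
    (h : AnalyticAt ℂ ρ (0, star ζ)) (hw : rhoDeriv ρ 0 1 ζ ≠ 0) {α : Fin (m + 1) → Fin n → ℕ}
    {s : Fin n → ℂ} {i k : Fin (m + 1) → Fin n} {c : Fin (m + 1) → ℂ} {v : CSpace n}
    (hα : ∀ j, rhoDeriv ρ (α j) 0 ζ =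
      fderiv ℂ (fderiv ℂ ρ) (0, star ζ) (zDir (i j), 0) (zDir (k j), 0))
    (hrel : ∑ j, c j * fderiv ℂ (fderiv ℂ ρ) (0, star ζ) (tangentDir s (i j), 0)
      (tangentDir s (k j), 0) + fderiv ℂ ρ (0, star ζ) (v, 0) = 0) :
    RelationAt ρ α c (relationPoly s i k c v) ζ := by
  have hsymm : IsSymmSndFDerivAt ℂ ρ (0, star ζ) :=
    (h.contDiffAt (n := 2)).isSymmSndFDerivAt (by simp)
  have hL : ∀ i, ((tangentDir s i, 0) : CSpace n × CSpace n) =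
      (zDir i, 0) - s i • (wDir, 0) := fun i => by simp [tangentDir]
  have h2 : ∀ j, fderiv ℂ (fderiv ℂ ρ) (0, star ζ) (tangentDir s (i j), 0)
      (tangentDir s (k j), 0) = rhoDeriv ρ (α j) 0 ζ -
        (s (k j) * rhoDeriv ρ (Pi.single (i j) 1) 1 ζ +
          s (i j) * rhoDeriv ρ (Pi.single (k j) 1) 1 ζ -
          s (i j) * s (k j) * rhoDeriv ρ 0 2 ζ) := by
    intro j
    rw [hα, rhoDeriv_zw h, rhoDeriv_zw h, rhoDeriv_ww h, hL, hL]
    simp only [map_sub, map_smul, sub_apply, smul_apply, smul_eq_mul]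
    rw [hsymm.eq (wDir, 0) (zDir (k j), 0)]
    ring
  have h1 : fderiv ℂ ρ (0, star ζ) (v, 0) =
      ∑ l, v.1 l * rhoDeriv ρ (Pi.single l 1) 0 ζ + v.2 * rhoDeriv ρ 0 1 ζ := by
    have hv : ((v, 0) : CSpace n × CSpace n) =
        ContinuousLinearMap.inl ℂ (CSpace n) (CSpace n) v := rfl
    conv_lhs => rw [hv, eq_sum_zDir_add_wDir v]
    simp only [map_add, map_sum, map_smul, smul_eq_mul, rhoDeriv_z h, rhoDeriv_w h]
    rfl
  simp only [h2, h1] at hrel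
  simp only [RelationAt, relationPoly, map_sub, map_add, map_sum, MvPolynomial.smul_eval,
    MvPolynomial.eval_X, MvPolynomial.eval_C, RelVar.value]
  have h3 : ∑ j, c j * rhoDeriv ρ (α j) 0 ζ = ∑ j, c j *
      (s (k j) * rhoDeriv ρ (Pi.single (i j) 1) 1 ζ +
          s (i j) * rhoDeriv ρ (Pi.single (k j) 1) 1 ζ -
          s (i j) * s (k j) * rhoDeriv ρ 0 2 ζ) -
      (∑ l, v.1 l * rhoDeriv ρ (Pi.single l 1) 0 ζ + v.2 * rhoDeriv ρ 0 1 ζ) := by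
    simp only [mul_sub (c _) (rhoDeriv ρ _ 0 ζ), Finset.sum_sub_distrib] at hrel
    linear_combination hrel
  have h4 := congrArg (· / rhoDeriv ρ 0 1 ζ) h3
  simp only [sub_div, add_div, Finset.sum_div, mul_div_assoc, div_self hw, mul_one] at h4
  exact h4

/-! ### Tangent spaces -/

/-- The real differential at `v` is the real part of `dρ(v, 0) + dρ(0, v̄)`, and the two summands
are conjugate. -/
theorem mem_realTangent_of_fderiv_eq_zero {n : ℕ} {ρ : CSpace n × CSpace n → ℂ}
    (hρ : AnalyticAt ℂ ρ 0) (hr : ∀ᶠ Z in 𝓝 (0 : CSpace n), (ρ (Z, star Z)).im = 0)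
    {v : CSpace n} (hv : fderiv ℂ ρ 0 (v, 0) = 0) : v ∈ realTangent ρ := by
  have hd : ∀ᶠ p in 𝓝 0, DifferentiableAt ℂ ρ p :=
    hρ.eventually_analyticAt.mono fun p hp => hp.differentiableAt
  have h1 : fderiv ℂ ρ 0 (0, star v) = 0 := by
    have := fderiv_conjSwap_of_real hd hr (v, 0)
    simpa [hv] using this
  let D : CSpace n →L[ℝ] CSpace n × CSpace n :=
    (ContinuousLinearMap.id ℝ _).prod
      ((starL' ℝ : CSpace n ≃L[ℝ] CSpace n) : CSpace n →L[ℝ] CSpace n)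
  have h2 : HasFDerivAt ρ ((fderiv ℂ ρ 0).restrictScalars ℝ) (D 0) := by
    rw [map_zero]; exact hρ.differentiableAt.hasFDerivAt.restrictScalars ℝ
  have h3 := Complex.reCLM.hasFDerivAt.comp (0 : CSpace n) (h2.comp (0 : CSpace n) D.hasFDerivAt)
  have h4 : HasFDerivAt (fun Z : CSpace n => (ρ (Z, star Z)).re)
    (Complex.reCLM.comp (((fderiv ℂ ρ 0).restrictScalars ℝ).comp D)) 0 := h3
  change fderiv ℝ (fun Z : CSpace n => (ρ (Z, star Z)).re) 0 v = 0
  rw [h4.fderiv]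
  change (fderiv ℂ ρ 0 (v, star v)).re = 0
  have h5 : ((v, star v) : CSpace n × CSpace n) = (v, 0) + (0, star v) := by simp
  rw [h5, map_add, hv, h1]
  simp

theorem mem_complexTangent_of_fderiv_eq_zero {n : ℕ} {ρ : CSpace n × CSpace n → ℂ}
    (hρ : AnalyticAt ℂ ρ 0) (hr : ∀ᶠ Z in 𝓝 (0 : CSpace n), (ρ (Z, star Z)).im = 0)
    {v : CSpace n} (hv : fderiv ℂ ρ 0 (v, 0) = 0) : v ∈ complexTangent ρ := by
  refine ⟨mem_realTangent_of_fderiv_eq_zero hρ hr hv,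
    mem_realTangent_of_fderiv_eq_zero hρ hr ?_⟩
  have : ((Complex.I • v, 0) : CSpace n × CSpace n) = Complex.I • (v, 0) := by simp
  rw [this, map_smul, hv, smul_zero]

theorem IsDefiningFunction.analyticAt {n : ℕ} {M Ω : Set (CSpace n)}
    {ρ : CSpace n × CSpace n → ℂ} (hρ : IsDefiningFunction M Ω ρ) {ζ : CSpace n} (hζ : ζ ∈ Ω) :
    AnalyticAt ℂ ρ (0, star ζ) :=
  hρ.analytic _ ⟨hρ.zero_mem, by simpa using hζ⟩

theorem AnalyticAt.clm_eval {E F G : Type*} [NormedAddCommGroup E] [NormedSpace ℂ E]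
    [NormedAddCommGroup F] [NormedSpace ℂ F] [NormedAddCommGroup G] [NormedSpace ℂ G]
    {f : E → F →L[ℂ] G} {x : E} (hf : AnalyticAt ℂ f x) (v : F) :
    AnalyticAt ℂ (fun p => f p v) x :=
  ((ContinuousLinearMap.apply ℂ G v).analyticAt _).comp hf

/-- Only real analyticity holds, because `ζ` enters through `ζ̄`. The expression is not divided by
`ρ_w`, so zeros of `ρ_w` do no harm. -/
theorem analyticAt_secondOrder {n : ℕ} {ρ : CSpace n × CSpace n → ℂ} {ζ : CSpace n}
    (h : AnalyticAt ℂ ρ (0, star ζ)) {J : Type*} (t : Finset J) (c : J → ℂ) (u v : J → CSpace n)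
    (w : CSpace n) :
    AnalyticAt ℝ (fun ζ => ∑ j ∈ t, c j * fderiv ℂ (fderiv ℂ ρ) (0, star ζ) (u j, 0) (v j, 0) +
      fderiv ℂ ρ (0, star ζ) (w, 0)) ζ := by
  have hs : AnalyticAt ℝ (fun ζ : CSpace n => ((0 : CSpace n), star ζ)) ζ :=
    analyticAt_const.prod
      (((starL' ℝ : CSpace n ≃L[ℝ] CSpace n) : CSpace n →L[ℝ] CSpace n).analyticAt ζ)
  have h1 : AnalyticAt ℂ (fun p => ∑ j ∈ t, c j * fderiv ℂ (fderiv ℂ ρ) p (u j, 0) (v j, 0) +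
      fderiv ℂ ρ p (w, 0)) (0, star ζ) := by
    refine (Finset.analyticAt_fun_sum t fun j _ => analyticAt_const.mul ?_).add ?_
    · exact (h.fderiv.fderiv.clm_eval (u j, 0)).clm_eval (v j, 0)
    · exact h.fderiv.clm_eval (w, 0)
  exact h1.restrictScalars.comp_of_eq hs rfl

end

/-! ### The main theorem -/

theorem corollary7p3 {n m : ℕ} (M Ω : Set (CSpace n)) (ρ : CSpace n × CSpace n → ℂ)
    (hρ : IsDefiningFunction M Ω ρ)
    (hM : TransversallyEmbeddableInHyperquadric M (n + m))
    (I : Finset (Fin n)) (hI : I ⊂ Finset.univ)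
    (α : Fin (m + 1) → Fin n → ℕ)
    (hα : ∀ j, ∑ i, α j i = 2) (hαI : ∀ j i, α j i ≠ 0 → i ∈ I) :
    ∃ (c : Fin (m + 1) → ℂ) (R : MvPolynomial (RelVar n) ℂ),
      c ≠ 0 ∧ R.totalDegree ≤ 1 ∧
      (∀ᶠ ζ in 𝓝 (0 : CSpace n), ζ ∈ distinguishedSegre Ω ρ (coordTangent ρ I) →
        rhoDeriv ρ 0 1 ζ ≠ 0 ∧ RelationAt ρ α c R ζ) ∧
      (∀ A ⊆ distinguishedSegre Ω ρ (coordTangent ρ I), (0 : CSpace n) ∈ A → IsConnected A →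
        IsComplexSubmanifold A → ∀ ζ ∈ A, rhoDeriv ρ 0 1 ζ ≠ 0 → RelationAt ρ α c R ζ) := by
  obtain ⟨T, B, M', W, H, ⟨hB, rfl⟩, hH, htrans⟩ := hM
  have hΩ : ∀ᶠ ζ in 𝓝 (0 : CSpace n), ζ ∈ Ω := hρ.isOpen.mem_nhds hρ.zero_mem
  have han : AnalyticAt ℂ ρ 0 := by
    simpa [Prod.mk_zero_zero] using hρ.analyticAt hρ.zero_mem
  have hreal : ∀ᶠ Z in 𝓝 (0 : CSpace n), (ρ (Z, star Z)).im = 0 :=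
    hΩ.mono fun Z hZ => hρ.real Z hZ
  have hρ0 : ρ 0 = 0 := by
    simpa [Prod.mk_zero_zero] using (hρ.mem_iff 0 hρ.zero_mem).1 hρ.zero_mem_hypersurface
  have hw0 : fderiv ℂ ρ 0 (wDir, 0) ≠ 0 := by
    have := hρ.rho_w_ne_zero
    rwa [rhoDeriv_w (hρ.analyticAt hρ.zero_mem), star_zero, Prod.mk_zero_zero] at this
  have hH0 : AnalyticAt ℂ H 0 := hH.holomorphic 0 (hH.subset hρ.zero_mem_hypersurface)
  set h : CSpace n → CSpace (n + m) := fun Z => T (H Z) with hh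
  have hhan : AnalyticAt ℂ h 0 :=
    ((T : CSpace (n + m) →L[ℂ] CSpace (n + m)).analyticAt (H 0)).comp hH0
  have hh' : ∀ v, fderiv ℂ h 0 v = T (fderiv ℂ H 0 v) := fun v => DFunLike.congr_fun
    (T.hasFDerivAt.comp (0 : CSpace n) hH0.differentiableAt.hasFDerivAt).fderiv v
  have hinj : Function.Injective (fderiv ℂ h 0) := fun u v huv => by
    rw [hh', hh'] at huv
    exact hH.immersion 0 (hH.subset hρ.zero_mem_hypersurface) (T.injective huv)
  have hmult := eventually_exists_multiplier (A := B) han hρ0 hreal hw0 hhan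
    (hΩ.mono fun Z hZ hz =>
      quadricEq_self_eq_zero hB (hH.mapsTo ((hρ.mem_iff Z hZ).2 hz)))
    (by
      obtain ⟨v, hv⟩ := exists_quadricPolar_ne_zero hB T (htrans 0 hρ.zero_mem_hypersurface)
      exact ⟨v, by rwa [hh']⟩)
  choose i k hi hk hd2 using fun j => exists_rhoDeriv_of_sum_eq_two (hα j)
  -- This slope makes `tangentDir s l` complex tangent to `M` at `0`.
  set s : Fin n → ℂ := fun l => fderiv ℂ ρ 0 (zDir l, 0) / fderiv ℂ ρ 0 (wDir, 0) with hs
  -- The codimension is `(n + m + 1) - (n + 1) = m`. Only the 2-jet of `h` at `0` and `s` enter, so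
  -- `c` and `v` are independent of `ζ`.
  obtain ⟨c, v, hc, hcv⟩ := exists_relation_modulo_range (D := (fderiv ℂ h 0).toLinearMap)
    (m := m) hinj (by simp [add_right_comm])
    fun j => fderiv ℂ (fderiv ℂ h) 0 (tangentDir s (i j)) (tangentDir s (k j))
  have htan : ∀ l ∈ I, tangentDir s l ∈ coordTangent ρ I := by
    intro l hl
    refine ⟨Submodule.subset_span ⟨l, hl, by simp [tangentDir, zDir, wDir]⟩,
      mem_complexTangent_of_fderiv_eq_zero han hreal ?_⟩
    have : ((tangentDir s l, 0) : CSpace n × CSpace n) = (zDir l, 0) - s l • (wDir, 0) := by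
      simp [tangentDir]
    rw [this, map_sub, map_smul, smul_eq_mul, hs]
    field_simp
    ring
  have hrel : ∀ᶠ ζ in 𝓝 (0 : CSpace n), ζ ∈ distinguishedSegre Ω ρ (coordTangent ρ I) →
      ∑ j, c j * fderiv ℂ (fderiv ℂ ρ) (0, star ζ) (tangentDir s (i j), 0)
        (tangentDir s (k j), 0) + fderiv ℂ ρ (0, star ζ) (v, 0) = 0 := by
    filter_upwards [hmult] with ζ hζ hmem
    obtain ⟨⟨hζΩ, hζ0⟩, hV⟩ := hmem
    obtain ⟨a, ha, ha1, ha2⟩ := hζ (by simpa using hζ0)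
    have hker : ∀ l ∈ I, fderiv ℂ ρ (0, star ζ) (tangentDir s l, 0) = 0 := fun l hl => by
      rw [← fderiv_slice_apply (hρ.analyticAt hζΩ).differentiableAt]
      exact hV (htan l hl)
    -- The dependence on `ζ` enters only through this functional, and the multiplier `a` then
    -- factors out of every term.
    have h1 := congrArg (quadricPolar B (h ζ)) hcv
    simp only [map_add, map_sum, map_smul, map_zero, smul_eq_mul,
      ContinuousLinearMap.coe_coe] at h1
    rw [ha1, Finset.sum_congr rfl fun j _ => by
      rw [ha2 _ _ (hker _ (hαI j _ (hi j))) (hker _ (hαI j _ (hk j)))]] at h1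
    refine (mul_eq_zero.1 (?_ : a * _ = 0)).resolve_left ha
    rw [← h1, mul_add, Finset.mul_sum]
    congr 1
    exact Finset.sum_congr rfl fun j _ => by ring
  have hw : ∀ᶠ ζ in 𝓝 (0 : CSpace n), fderiv ℂ ρ (0, star ζ) (wDir, 0) ≠ 0 := by
    have h1 : ContinuousAt (fun p => fderiv ℂ ρ p (wDir, 0)) 0 :=
      han.fderiv.continuousAt.clm_apply continuousAt_const
    have h2 : Filter.Tendsto (fun ζ : CSpace n => ((0 : CSpace n), star ζ)) (𝓝 0) (𝓝 0) :=
      Continuous.tendsto' (by fun_prop) 0 0 (by simp)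
    exact h2.eventually (h1.eventually_ne hw0)
  refine ⟨c, relationPoly s i k c v, hc, totalDegree_relationPoly_le _ _ _ _ _, ?_, ?_⟩
  · filter_upwards [hrel, hw, hΩ] with ζ h1 h2 h3 hmem
    have h4 := hρ.analyticAt h3
    have h5 : rhoDeriv ρ 0 1 ζ ≠ 0 := by rwa [rhoDeriv_w h4]
    exact ⟨h5, relationAt_relationPoly h4 h5 (fun j => hd2 j ρ ζ h4) (h1 hmem)⟩
  · intro A hA h0A hconn hsub ζ hζ hζw
    have h4 : ∀ ζ ∈ A, AnalyticAt ℂ ρ (0, star ζ) := fun ζ hζ => hρ.analyticAt (hA hζ).1.1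
    -- The undivided relation is continued along `A` first; division by `ρ_w` takes place only at
    -- the point `ζ`.
    exact relationAt_relationPoly (h4 ζ hζ) hζw (fun j => hd2 j ρ ζ (h4 ζ hζ))
      (hsub.eqOn_zero hconn (fun a ha => analyticAt_secondOrder (h4 a ha) _ _ _ _ _) h0A
        (hrel.mono fun a ha haA => ha (hA haA)) ζ hζ)
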